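/- **Setting.** Let $\overline M$ be a compact oriented 3-manifold whose boundary is a nonempty union of tori, decomposed into finitely many truncated tetrahedra $\Delta_1,\dots,\Delta_n$ ($n\ge 1$) glued in pairs along all their hexagonal faces; this is an ideal triangulation $\tau$ of $M=\overline M\smallsetminus\partial\overline M$, and the truncated tips tile $\partial\overline M$ by *cusp triangles*. A vertex $v$ of this tiling is an end of an interior edge of $M$. An angle vector assigns a real number to each pair of opposite edges of each tetrahedron (hence to each corner of each cusp triangle). It is a *generalized angle structure* if the three angles of each tetrahedron sum to $\pi$ and the angles around each interior edge sum to $2\pi$; it is *taut* if moreover all angles are in $\{0,\pi\}$, and *positive* if moreover all angles are $>0$. For a taut structure, corners with angle $\pi$ are *wide* and corners with angle $0$ are *thin*; the two sequences of thin corners at a vertex $v$ of $\partial\overline M$ between its two wide corners are the *fans* of $v$. A taut structure is *veering* if at each vertex $v$ either all triangles of both fans have their wide corner immediately before $v$ in counterclockwise order ($v$ and its interior edge are then *left-veering*, or blue), or all of them have it immediately after $v$ (*right-veering*, or red). It is *transverse-taut* if there is a transverse orientation of the faces such that, in each tetrahedron, the two faces sharing one of the $\pi$-edges are oriented inward and the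 two faces sharing the other one are oriented outward. Let $d_{\max}$ be the maximum number of triangles in a fan of any vertex $v\in\partial\overline M$, and $e_{\max}$ the largest degree of an interior edge. **Notation for the construction.** For an oriented closed normal curve $\gamma$ in $\partial\overline M$ let $D^\gamma=\sum_e(\varepsilon_{j_e}-\varepsilon_{j'_e})$, where $e$ runs over the segments crossed by $\gamma$ (with multiplicity), $j_e$ is the angle opposite $e$ in the triangle entered by $\gamma$ and $j'_e$ the angle opposite $e$ in the triangle left by $\gamma$. For an interior edge $\epsilon$ let $D^\epsilon=D^{\gamma_v}$ with $\gamma_v$ the clockwise loop around either end $v$ of $\epsilon$, and $D=\sum_{\epsilon\text{ blue}}D^\epsilon-\sum_{\epsilon\text{ red}}D^\epsilon$. A tetrahedron (and each of its cusp triangles) is a *hinge* if its two $\pi$-edges have different colours. The segments of $\partial\overline M$ joining vertices of the same colour (*ladderpoles*) cut $\partial\overline M$ into annuli (*ladders*), whose other segments are *rungs*; each triangle has one ladderpole segment. The transverse orientation defines an upward direction along the ladders; a ladder is *ascending* if the wide corner of each of its triangles is above the opposite side, and *descending* if it is below. Let $\mathcal T$ be the set of cusp triangles in ascending ladders; each tetrahedron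 has exactly two triangles in $\mathcal T$, exchanged by an involution $\sigma$. For $T\in\mathcal T$ the *height* $H(T)$ is the number of steps down its ladder from $T$ to the nearest hinge triangle. If $T$ is not a hinge, $\gamma_T$ is the closed curve that enters $T$ through its ladderpole segment from the adjacent descending ladder, travels $H(T)$ rungs down to that hinge triangle, crosses back through the ladderpole segment of the hinge triangle, and travels up across the rungs of the descending ladder to close up; if $T$ is a hinge, $\gamma_T$ is empty. **Proposition.** Let $(\theta_0)$ be a veering, transverse-taut angle structure on $\tau$. Then $d_{\max}\ge 1$, $e_{\max}>3$, and $\tau$ admits a positive angle structure $(\theta)$ whose angles all satisfy $$\theta_i\ \ge\ \frac{\pi}{12\,d_{\max}^2}\ \ge\ \frac{\pi}{12\,(e_{\max}-3)^2},$$ namely $$(\theta)=(\theta_0)+\frac{\pi}{6}\,D+\sum_{T\in\mathcal T}\frac{\pi}{24\,d_{\max}^2}\,H(\sigma(T))\,D^{\gamma_T}.$$ -/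

import Mathlib

noncomputable section

namespace Veering

/-! ## Tetrahedra

The vertices of each tetrahedron are labelled `0, 1, 2, 3`; the face `f` is the face opposite the
vertex `f`. The three pairs of opposite edges are indexed by `Fin 3`:
pair `0` is `{01, 23}`, pair `1` is `{02, 13}`, pair `2` is `{03, 12}`. -/

/-- `mate p v` is the vertex `w` for which the edge `vw` belongs to the pair `p` of opposite
edges. -/
def mate (p : Fin 3) (v : Fin 4) : Fin 4 :=
  (![![1, 0, 3, 2], ![2, 3, 0, 1], ![3, 2, 1, 0]] : Fin 3 → Fin 4 → Fin 4) p v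

/-- `pairOf v w` is the pair of opposite edges that contains the edge `vw` (for `v ≠ w`; the
value on the diagonal is irrelevant). -/
def pairOf (v w : Fin 4) : Fin 3 :=
  (![![0, 0, 1, 2], ![0, 0, 2, 1], ![1, 2, 0, 0], ![2, 1, 0, 0]] : Fin 4 → Fin 4 → Fin 3) v w

theorem pairOf_mate : ∀ (p : Fin 3) (v : Fin 4), pairOf v (mate p v) = p := by decide

theorem mate_pairOf : ∀ v w : Fin 4, v ≠ w → mate (pairOf v w) v = w := by decide

/-- An oriented ideal triangulation with set of tetrahedra `ι`: the face `f` of the tetrahedron `i`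
is glued to a face of `nbr i f`, the vertices being matched by the permutation `glue i f` (so the
face is glued to the face `glue i f f`, and `v ≠ f` goes to `glue i f v`).
The faces are glued in pairs, and the gluings reverse the orientations of the faces induced by the
vertex orderings of the tetrahedra, so that the quotient is oriented.

Truncating the tips gives a compact oriented manifold whose boundary components are closed oriented
surfaces tiled by the cusp triangles. No torus condition is listed: if there is a taut angle
structure, then each cusp triangle has angle sum `π`, each vertex of the boundary has angle sum
`2π`, so every boundary component has Euler characteristic `0` and is a torus. -/
structure IdealTriangulation (ι : Type*) where
  nbr : ι → Fin 4 → ι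
  glue : ι → Fin 4 → Equiv.Perm (Fin 4)
  nbr_nbr : ∀ i f, nbr (nbr i f) (glue i f f) = i
  glue_glue : ∀ i f, glue (nbr i f) (glue i f f) = (glue i f)⁻¹
  glue_odd : ∀ i f, Equiv.Perm.sign (glue i f) = -1
  not_self_glued : ∀ i f, (nbr i f, glue i f f) ≠ (i, f)

/-- `(i, v)` is the cusp triangle cut off at the vertex `v` of the tetrahedron `i`. -/
abbrev CuspTriangle (ι : Type*) := ι × Fin 4

/-- `(i, v, p)` is the corner of the cusp triangle `(i, v)` on the edge from `v` to `mate p v` of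
the tetrahedron `i`. Equivalently, it is that edge with a preferred end `v`.
For every `v`, the corners `(i, v, 0)`, `(i, v, 1)`, `(i, v, 2)` follow each other in
counterclockwise order around the cusp triangle (this is the orientation of the tetrahedron). -/
abbrev Corner (ι : Type*) := ι × Fin 4 × Fin 3

/-- `(i, v, p)`, used as a side, is the side of the cusp triangle `(i, v)` opposite the corner
`(i, v, p)`; it lies in the face `mate p v` of the tetrahedron `i`. -/
abbrev Side (ι : Type*) := ι × Fin 4 × Fin 3

/-- One real variable for every pair of opposite edges of every tetrahedron. The angle of a cusp
triangle `(i, v)` at its corner `(i, v, p)` is `θ i p`. -/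
abbrev AngleVector (ι : Type*) := ι → Fin 3 → ℝ

/-- The basis vector of the angle at the corner `c`, equivalently of the angle opposite the
side `c`. -/
def basisVec {ι : Type*} (c : Corner ι) : AngleVector ι :=
  open Classical in fun i p => if i = c.1 ∧ p = c.2.2 then 1 else 0

/-- The corner of the same cusp triangle that comes immediately after `c` in counterclockwise
order. -/
def ccwAfter {ι : Type*} (c : Corner ι) : Corner ι := (c.1, c.2.1, c.2.2 + 1)

/-- The corner of the same cusp triangle that comes immediately before `c` in counterclockwise
order. -/
def ccwBefore {ι : Type*} (c : Corner ι) : Corner ι := (c.1, c.2.1, c.2.2 + 2)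

/-- The same edge of the same tetrahedron, with the other end preferred. -/
def rev {ι : Type*} (c : Corner ι) : Corner ι := (c.1, mate c.2.2 c.2.1, c.2.2)

namespace IdealTriangulation

variable {ι : Type*} (τ : IdealTriangulation ι)

/-- The same segment of the tiling of the boundary, seen as a side of the cusp triangle on its other
side. -/
def cross (s : Side ι) : Side ι :=
  let f := mate s.2.2 s.2.1
  let g := τ.glue s.1 f
  (τ.nbr s.1 f, g s.2.1, pairOf (g s.2.1) (g f))

/-- The next corner in clockwise order around the vertex of the boundary at the corner `c`. The side
that is crossed is the one opposite `ccwBefore c`. -/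
def cw (c : Corner ι) : Corner ι :=
  let f := mate (c.2.2 + 2) c.2.1
  let g := τ.glue c.1 f
  (τ.nbr c.1 f, g c.2.1, pairOf (g c.2.1) (g (mate c.2.2 c.2.1)))

/-- Two corners lie at the same vertex of the tiling of the boundary. The corners at one vertex form
one (finite) cycle of `cw`; they are also the dihedral angles met when going once around the
corresponding interior edge. -/
def SameVertex (c c' : Corner ι) : Prop := ∃ k : ℕ, τ.cw^[k] c = c'

/-- All corners at the vertex of the boundary given by `c`. -/
def cornersAt [Fintype ι] (c : Corner ι) : Finset (Corner ι) :=
  open Classical in Finset.univ.filter (τ.SameVertex c)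

/-- The degree of the interior edge given by `c`. -/
def degree [Fintype ι] (c : Corner ι) : ℕ := (τ.cornersAt c).card

/-- The largest degree of an edge. -/
def eMax [Fintype ι] : ℕ := Finset.univ.sup τ.degree

/-- The identifications that produce the interior edges out of the edges of the tetrahedra:
gluing along faces, and forgetting the preferred end. -/
def edgeSetoid : Setoid (Corner ι) :=
  Relation.EqvGen.setoid fun c c' => c' = τ.cw c ∨ c' = rev c

/-- The interior edges of the triangulation. -/
def InteriorEdge : Type _ := Quotient τ.edgeSetoid

instance [Finite ι] : Finite τ.InteriorEdge := inferInstanceAs (Finite (Quotient τ.edgeSetoid))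

instance [Finite ι] : Fintype τ.InteriorEdge := Fintype.ofFinite _

/-- A corner on the edge `ε`, at one of the two ends of `ε`. -/
def InteriorEdge.corner {τ : IdealTriangulation ι} (ε : τ.InteriorEdge) : Corner ι :=
  Quotient.out (s := τ.edgeSetoid) ε

/-! ## Angle structures -/

section Angles

variable [Fintype ι] (θ : AngleVector ι)

/-- Generalized angle structures. -/
structure IsGeneralizedAngleStructure : Prop where
  tetrahedron : ∀ i, θ i 0 + θ i 1 + θ i 2 = Real.pi
  edge : ∀ c, ∑ c' ∈ τ.cornersAt c, θ c'.1 c'.2.2 = 2 * Real.pi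

/-- Positive angle structures. -/
def IsPositiveAngleStructure : Prop :=
  τ.IsGeneralizedAngleStructure θ ∧ ∀ i p, 0 < θ i p

/-- Taut angle structures. -/
def IsTaut : Prop :=
  τ.IsGeneralizedAngleStructure θ ∧ ∀ i p, θ i p = 0 ∨ θ i p = Real.pi

end Angles

section Taut

variable (θ : AngleVector ι)

/-- Wide corners of a taut angle structure. -/
def Wide (c : Corner ι) : Prop := θ c.1 c.2.2 = Real.pi

/-- Thin corners of a taut angle structure. -/
def Thin (c : Corner ι) : Prop := θ c.1 c.2.2 = 0

/-- The vertex at `c` is left-veering: every triangle of its fans (that is, with a thin corner at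
the vertex) has its wide corner immediately before the vertex in counterclockwise order. The
corresponding edge is then coloured blue. -/
def Blue (c : Corner ι) : Prop :=
  ∀ c', τ.SameVertex c c' → Thin θ c' → Wide θ (ccwBefore c')

/-- The vertex at `c` is right-veering: every triangle of its fans has its wide corner immediately
after the vertex in counterclockwise order. The corresponding edge is then coloured red. -/
def Red (c : Corner ι) : Prop :=
  ∀ c', τ.SameVertex c c' → Thin θ c' → Wide θ (ccwAfter c')

/-- Veering (taut angle) structures. -/
def IsVeering [Fintype ι] : Prop :=
  τ.IsTaut θ ∧ ∀ c, τ.Blue θ c ∨ τ.Red θ c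

/-- The taut angle structure `θ` is transverse-taut with respect to `out`, a transverse orientation
of the faces, where `out i f = true` means that it points out of the tetrahedron `i` on the face
`f`. The first condition says that it is well defined on the glued faces. In the second condition,
the faces `f` and `mate p f` share one of the two edges of the pair `p`, and the two other faces
share the other one. -/
def IsTransverseTaut (out : ι → Fin 4 → Bool) : Prop :=
  (∀ i f, out (τ.nbr i f) (τ.glue i f f) = !out i f) ∧
  ∀ i p, θ i p = Real.pi → ∀ f, out i (mate p f) = out i f ∧
    ∀ f', f' ≠ f → f' ≠ mate p f → out i f' = !out i f

/-- The number of triangles in the fan that begins clockwise after the wide corner `c`: the number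
of thin corners that follow `c` before the next wide corner. (The set is nonempty since `cw` is
periodic.) -/
def fanLength (c : Corner ι) : ℕ := sInf {k | Wide θ (τ.cw^[k + 1] c)}

/-- The maximum number of triangles in a fan of any vertex. -/
def dMax [Fintype ι] : ℕ :=
  open Classical in (Finset.univ.filter (Wide θ)).sup (τ.fanLength θ)

/-! ## Leading-trailing deformations

A closed normal curve is given by the cyclic list of the sides through which it leaves the
triangles it traverses. -/

/-- The leading-trailing deformation of a curve: whenever it crosses a segment, the opposite angle in
the triangle entered increases and the opposite angle in the triangle left decreases. -/
def deformation (γ : List (Side ι)) : AngleVector ι :=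
  (γ.map fun s => basisVec (τ.cross s) - basisVec s).sum

/-- The clockwise loop around the vertex of the boundary given by `c`. -/
def vertexLoop [Fintype ι] (c : Corner ι) : List (Side ι) :=
  (List.range (τ.degree c)).map fun k => ccwBefore (τ.cw^[k] c)

/-- The deformation of an interior edge (both ends of the edge give the same one). -/
def edgeDeformation [Fintype ι] (ε : τ.InteriorEdge) : AngleVector ι :=
  τ.deformation (τ.vertexLoop ε.corner)

/-- The sum of the deformations of the blue edges minus the sum of those of the red edges. -/
def hingeDeformation [Fintype ι] : AngleVector ι :=
  open Classical in
  ∑ ε : τ.InteriorEdge with τ.Blue θ ε.corner, τ.edgeDeformation ε -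
    ∑ ε : τ.InteriorEdge with τ.Red θ ε.corner, τ.edgeDeformation ε

/-! ## Ladders -/

/-- The pair of wide edges of the tetrahedron `i`, for a taut angle structure. The wide corner of a
cusp triangle `(i, v)` is `(i, v, widePair θ i)`, and its base is the side with the same name. -/
def widePair (i : ι) : Fin 3 :=
  open Classical in
  if θ i 0 = Real.pi then 0 else if θ i 1 = Real.pi then 1 else 2

/-- A tetrahedron is a hinge if its two wide edges have different colours. -/
def IsHinge (i : ι) : Prop :=
  ∃ v v', τ.Blue θ (i, v, widePair θ i) ∧ τ.Red θ (i, v', widePair θ i)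

/-- A ladderpole segment is a side joining two vertices of the same colour; the other sides are
rungs. -/
def IsLadderpole (s : Side ι) : Prop :=
  (τ.Blue θ (ccwAfter s) ∧ τ.Blue θ (ccwBefore s)) ∨ (τ.Red θ (ccwAfter s) ∧ τ.Red θ (ccwBefore s))

/-- The ladderpole side of a cusp triangle (in a veering structure there is exactly one). -/
def poleSide (T : CuspTriangle ι) : Side ι :=
  open Classical in
  if τ.IsLadderpole θ (T.1, T.2, 0) then (T.1, T.2, 0)
  else if τ.IsLadderpole θ (T.1, T.2, 1) then (T.1, T.2, 1)
  else (T.1, T.2, 2)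

/-- The base of a cusp triangle, which is the side opposite its wide corner (always a rung). -/
def baseSide (T : CuspTriangle ι) : Side ι := (T.1, T.2, widePair θ T.1)

/-- The transverse orientation, which defines the upward direction along the ladders, crosses the
base of `T` into `T`. Equivalently, the wide corner of `T` is above its base, that is, `T` belongs
to an ascending ladder. -/
def IsAscending (out : ι → Fin 4 → Bool) (T : CuspTriangle ι) : Prop :=
  out T.1 (mate (widePair θ T.1) T.2) = false

/-- All cusp triangles in ascending ladders. -/
def ascending [Fintype ι] (out : ι → Fin 4 → Bool) : Finset (CuspTriangle ι) :=
  open Classical in Finset.univ.filter (IsAscending θ out)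

/-- The cusp triangle adjacent to `T` along the base of `T`. This is the next triangle of the ladder,
downward in an ascending ladder and upward in a descending one. -/
def acrossBase (T : CuspTriangle ι) : CuspTriangle ι :=
  ((τ.cross (baseSide θ T)).1, (τ.cross (baseSide θ T)).2.1)

/-- The height of a triangle in an ascending ladder: the number of steps down the ladder to the
nearest hinge triangle. -/
def height (T : CuspTriangle ι) : ℕ :=
  sInf {k | τ.IsHinge θ ((τ.acrossBase θ)^[k] T).1}

/-- The first hinge triangle met going down an ascending ladder from `T`. -/
def hingeBelow (T : CuspTriangle ι) : CuspTriangle ι := (τ.acrossBase θ)^[τ.height θ T] T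

/-- The curve `γ_T` of a triangle `T` in an ascending ladder: it enters `T` from the adjacent ladder
through the ladderpole side, travels down the ladder to the nearest hinge triangle, crosses back
through the ladderpole side of this hinge triangle into the descending ladder, and travels up across
the rungs of that ladder to close up. The curve is empty if `T` is a hinge triangle. -/
def rescueCurve (T : CuspTriangle ι) : List (Side ι) :=
  open Classical in
  let start := τ.cross (τ.poleSide θ T)
  let ret := τ.cross (τ.poleSide θ (τ.hingeBelow θ T))
  let S : CuspTriangle ι := (ret.1, ret.2.1)
  let m := sInf {k | (τ.acrossBase θ)^[k] S = (start.1, start.2.1)}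
  if τ.IsHinge θ T.1 then []
  else [start] ++ (List.range (τ.height θ T)).map (fun k => baseSide θ ((τ.acrossBase θ)^[k] T)) ++
    [τ.poleSide θ (τ.hingeBelow θ T)] ++
    (List.range m).map (fun k => baseSide θ ((τ.acrossBase θ)^[k] S))

/-- The sum over all triangles `T` in ascending ladders of `H(σ(T)) D^{γ_T}`, where `σ(T)` is the
only other triangle in an ascending ladder that belongs to the same tetrahedron (the inner sum has
exactly one term). -/
def rescueDeformation [Fintype ι] (out : ι → Fin 4 → Bool) : AngleVector ι :=
  open Classical in
  ∑ T ∈ ascending θ out, ∑ T' ∈ ascending θ out with T'.1 = T.1 ∧ T' ≠ T,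
    (τ.height θ T' : ℝ) • τ.deformation (τ.rescueCurve θ T)

end Taut

end IdealTriangulation

end Veering

end

/-! Every closed normal curve deforms generalized angle structures into generalized angle structures
(`IsClosedCurve.deformation_mem`), so only lower bounds for the angles are at stake. Write d for
`dMax`, H for the height, σ for `sibling`.

Adding π/6 times `hingeDeformation` turns all angles of a hinge tetrahedron into π/3. In any other
tetrahedron the wide angle becomes π/3 and the thin ones become 2π/3 and 0
(`hingeDeformation_widePair`, `hingeDeformation_of_isHinge`, `hingeDeformation_of_not_isHinge`). The
angle that is still 0 faces the ladderpole sides, and the curves γ_T raise it.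

Entering T through its ladderpole side raises that angle by the weight H(σ(T)), and leaving the
descending triangle on the other side lowers the corresponding angle there by the same amount. In a
tetrahedron that is not a hinge, with ascending triangles T₁ and T₂, the gain is H(T₁) + H(T₂). The
ladderpole side of each descending triangle lies in the same face as the base of one T_j, so that
the sibling of the ascending triangle across the pole is the triangle just below T_j
(`acrossBase_eq_sibling`). The loss is thus at most H(T_j) - 1 for each j, and the net gain is at
least 2 (`rescueDeformation_pole`).

The other angles lose a bounded amount. A fan bounds the length of a monochromatic stretch of a
ladder, whence H ≤ d - 2 (`height_add_two_le`). Curves that pass down through a given triangle share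
their hinge, as do those that pass up through it from one given side, so their total weight is at
most (d - 2)² (`sum_weight_le`). A wide angle loses at most 6(d - 2)² and a thin hinge angle at most
2(d - 2)² + 2(d - 2). With coefficient π/(24 d²) these losses stay below π/3, and the gain of 2
becomes π/(12 d²). Finally d + 3 ≤ `eMax`, because a vertex with a fan of length d also has two wide
corners and a second, nonempty fan. -/

namespace Veering

/-! ### Labels of the edges of a tetrahedron, and corners of a cusp triangle. -/

theorem add_one_add_one : ∀ p : Fin 3, p + 1 + 1 = p + 2 := by decide

theorem add_one_add_two : ∀ p : Fin 3, p + 1 + 2 = p := by decide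

theorem add_two_add_one : ∀ p : Fin 3, p + 2 + 1 = p := by decide

theorem add_two_add_two : ∀ p : Fin 3, p + 2 + 2 = p + 1 := by decide

theorem mate_mate : ∀ (p : Fin 3) (v : Fin 4), mate p (mate p v) = v := by decide

theorem mate_ne : ∀ (p : Fin 3) (v : Fin 4), mate p v ≠ v := by decide

theorem mate_injective_left : ∀ (p q : Fin 3) (v : Fin 4), mate p v = mate q v → p = q := by decide

theorem mate_add_one_mate : ∀ (p : Fin 3) (v : Fin 4), mate (p + 1) (mate p v) = mate (p + 2) v := by
  decide

theorem mate_add_two_mate : ∀ (p : Fin 3) (v : Fin 4), mate (p + 2) (mate p v) = mate (p + 1) v := by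
  decide

theorem pairOf_comm : ∀ v w : Fin 4, pairOf v w = pairOf w v := by decide

set_option maxRecDepth 100000 in
set_option maxHeartbeats 4000000 in
/-- An odd permutation reverses the cyclic order of the edges at a vertex. -/
theorem pairOf_odd : ∀ g : Equiv.Perm (Fin 4), Equiv.Perm.sign g = -1 → ∀ v p,
    pairOf (g v) (g (mate (p + 1) v)) = pairOf (g v) (g (mate p v)) + 2 := by
  decide

set_option maxRecDepth 100000 in
set_option maxHeartbeats 4000000 in
/-- Permutations map pairs of opposite edges to pairs of opposite edges. -/
theorem pairOf_opposite : ∀ g : Equiv.Perm (Fin 4), ∀ v p,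
    pairOf (g (mate (p + 1) v)) (g (mate (p + 2) v)) = pairOf (g v) (g (mate p v)) := by
  decide

section Corners

variable {ι : Type*}

@[simp] theorem ccwAfter_ccwBefore (c : Corner ι) : ccwAfter (ccwBefore c) = c := by
  obtain ⟨i, v, p⟩ := c
  simp [ccwAfter, ccwBefore, add_two_add_one]

@[simp] theorem ccwBefore_ccwAfter (c : Corner ι) : ccwBefore (ccwAfter c) = c := by
  obtain ⟨i, v, p⟩ := c
  simp [ccwAfter, ccwBefore, add_one_add_two]

@[simp] theorem ccwBefore_ccwBefore (c : Corner ι) : ccwBefore (ccwBefore c) = ccwAfter c := by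
  obtain ⟨i, v, p⟩ := c
  simp [ccwAfter, ccwBefore, add_two_add_two]

@[simp] theorem ccwAfter_ccwAfter (c : Corner ι) : ccwAfter (ccwAfter c) = ccwBefore c := by
  obtain ⟨i, v, p⟩ := c
  simp [ccwAfter, ccwBefore, add_one_add_one]

@[simp] theorem rev_rev (c : Corner ι) : rev (rev c) = c := by
  obtain ⟨i, v, p⟩ := c
  simp [rev, mate_mate]

theorem rev_ne (c : Corner ι) : rev c ≠ c := by
  obtain ⟨i, v, p⟩ := c
  simp [rev, mate_ne]

/-- A corner on the edge opposite to the edge of `c` in its tetrahedron. -/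
def opp (c : Corner ι) : Corner ι := (c.1, mate (c.2.2 + 1) c.2.1, c.2.2)

/-- The cusp triangle of a corner or a side. -/
def triangle (c : Corner ι) : CuspTriangle ι := (c.1, c.2.1)

end Corners

/-! ### The tiling of the boundary: crossing a segment, rotating about a vertex, exchanging the ends
of an edge. -/

namespace IdealTriangulation

variable {ι : Type*} (τ : IdealTriangulation ι)

theorem cross_cross (s : Side ι) : τ.cross (τ.cross s) = s := by
  obtain ⟨i, v, p⟩ := s
  have h : τ.glue i (mate p v) v ≠ τ.glue i (mate p v) (mate p v) := fun h =>
    mate_ne p v ((τ.glue i (mate p v)).injective h).symm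
  simp [cross, mate_pairOf _ _ h, τ.nbr_nbr, τ.glue_glue, pairOf_mate]

theorem cross_injective : Function.Injective τ.cross :=
  Function.LeftInverse.injective τ.cross_cross

/-- The orientation enters here: an odd gluing reverses the cyclic order of the corners, so a vertex
that comes just after the crossed side on one side comes just before it on the other. -/
theorem cw_eq (c : Corner ι) : τ.cw c = ccwBefore (τ.cross (ccwBefore c)) := by
  obtain ⟨i, v, p⟩ := c
  have h := pairOf_odd _ (τ.glue_odd i (mate (p + 2) v)) v (p + 2)
  rw [add_two_add_one] at h
  simp [cross, cw, ccwBefore, h]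

theorem cw_ccwAfter (s : Side ι) : τ.cw (ccwAfter s) = ccwBefore (τ.cross s) := by
  simp [cw_eq]

theorem cw_ccwAfter_cross (s : Side ι) : τ.cw (ccwAfter (τ.cross s)) = ccwBefore s := by
  simp [cw_ccwAfter, cross_cross]

/-- Clockwise rotation about the vertices, as a permutation of the corners. -/
def cwPerm : Equiv.Perm (Corner ι) where
  toFun := τ.cw
  invFun c := ccwAfter (τ.cross (ccwAfter c))
  left_inv c := by simp [cw_eq, cross_cross]
  right_inv c := by simp [cw_eq, cross_cross]

@[simp] theorem cwPerm_apply (c : Corner ι) : τ.cwPerm c = τ.cw c := rfl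

theorem cw_injective : Function.Injective τ.cw := τ.cwPerm.injective

/-- `rev` conjugates `cw` to its inverse: a rotation about an edge is clockwise from one end and
counterclockwise from the other, and both steps cross the same face. -/
theorem cw_rev_cw (c : Corner ι) : τ.cw (rev (τ.cw c)) = rev c := by
  obtain ⟨i, v, p⟩ := c
  set f := mate (p + 2) v with hf
  set g := τ.glue i f with hg
  have h0 : ∀ a b, a ≠ b → g a ≠ g b := fun a b h => g.injective.ne h
  have hv : g v ≠ g (mate p v) := h0 _ _ (mate_ne p v).symm
  have h1 := pairOf_odd g (τ.glue_odd i f) v (p + 1)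
  have h2 := pairOf_odd g (τ.glue_odd i f) v p
  rw [add_one_add_one, h2, add_two_add_two, ← hf] at h1
  have hface : mate (pairOf (g v) (g (mate p v)) + 2) (g (mate p v)) = g f := by
    set q := pairOf (g v) (g (mate p v)) with hq
    have h6 : mate q (g v) = g (mate p v) := mate_pairOf _ _ hv
    rw [← h6, mate_add_two_mate, ← h1, mate_pairOf _ _ (h0 _ _ (mate_ne _ _).symm)]
  have hc : τ.cw (i, v, p) = (τ.nbr i f, g v, pairOf (g v) (g (mate p v))) := rfl
  rw [hc]
  have hr : rev (τ.nbr i f, g v, pairOf (g v) (g (mate p v))) =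
      (τ.nbr i f, g (mate p v), pairOf (g v) (g (mate p v))) := by
    simp [rev, mate_pairOf _ _ hv]
  rw [hr]
  have hm : mate (pairOf (g v) (g (mate p v))) (g (mate p v)) = g v := by
    rw [pairOf_comm, mate_pairOf _ _ hv.symm]
  simp only [cw, hface, hm]
  simp [hg, τ.nbr_nbr, τ.glue_glue, rev, pairOf_comm (mate p v) v, pairOf_mate]

/-- Equality would glue a face of a tetrahedron to a face of the same one while exchanging two of
its vertices; parity then forces the two faces to coincide, against `not_self_glued`. -/
theorem rev_ne_cw (c : Corner ι) : rev c ≠ τ.cw c := by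
  obtain ⟨i, v, p⟩ := c
  intro h
  set f := mate (p + 2) v with hf
  set g := τ.glue i f with hg
  have hc : τ.cw (i, v, p) = (τ.nbr i f, g v, pairOf (g v) (g (mate p v))) := rfl
  have h1 := τ.cw_rev_cw (i, v, p)
  rw [← h, rev_rev, hc] at h1
  have hrev : rev (i, v, p) = (i, mate p v, p) := rfl
  rw [hrev] at h1
  simp only [Prod.mk.injEq] at h1
  obtain ⟨hn, hgv, hpq⟩ := h1
  have hv : g v ≠ g (mate p v) := g.injective.ne (mate_ne p v).symm
  have h4 := pairOf_odd g (τ.glue_odd i f) v (p + 2)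
  rw [add_two_add_one, hpq] at h4
  have h5 : ∀ q r : Fin 3, q = r + 2 → r = q + 1 := by decide
  have h6 := h5 _ _ h4
  have h7 : g f = mate (p + 1) (g v) := by
    rw [← h6, mate_pairOf _ _ (g.injective.ne (mate_ne (p + 2) v).symm)]
  rw [hgv, mate_add_one_mate] at h7
  exact τ.not_self_glued i f (by rw [hn, ← hg, h7])

/-- The edge opposite to a side lies in the face that is crossed. -/
theorem rev_cw_opp (s : Side ι) : rev (τ.cw (opp s)) = opp (τ.cross s) := by
  obtain ⟨i, v, p⟩ := s
  set f := mate p v with hf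
  set g := τ.glue i f with hg
  have e1 : mate (p + 2) (mate (p + 1) v) = f := by
    have := mate_add_one_mate (p + 1) v
    rwa [add_one_add_one, add_one_add_two] at this
  have e2 : mate p (mate (p + 1) v) = mate (p + 2) v := by
    have := mate_add_two_mate (p + 1) v
    rwa [add_one_add_one, add_one_add_two] at this
  have hne : g (mate (p + 1) v) ≠ g (mate (p + 2) v) := by
    refine g.injective.ne fun h => ?_
    have h1 : ∀ p : Fin 3, p + 1 ≠ p + 2 := by decide
    exact h1 _ (mate_injective_left _ _ _ h)
  have hopp : opp (i, v, p) = (i, mate (p + 1) v, p) := rfl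
  have hcw : τ.cw (i, mate (p + 1) v, p) =
      (τ.nbr i f, g (mate (p + 1) v), pairOf (g (mate (p + 1) v)) (g (mate (p + 2) v))) := by
    simp only [cw, e1, e2, hg]
  rw [hopp, hcw]
  have hrev : rev (τ.nbr i f, g (mate (p + 1) v),
      pairOf (g (mate (p + 1) v)) (g (mate (p + 2) v))) =
      (τ.nbr i f, g (mate (p + 2) v), pairOf (g (mate (p + 1) v)) (g (mate (p + 2) v))) := by
    simp [rev, mate_pairOf _ _ hne]
  have hcross : τ.cross (i, v, p) = (τ.nbr i f, g v, pairOf (g v) (g f)) := rfl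
  rw [hrev, hcross, pairOf_opposite g v p]
  have h1 := pairOf_odd g (τ.glue_odd i f) v (p + 1)
  have h2 := pairOf_odd g (τ.glue_odd i f) v p
  rw [add_one_add_one, h2, add_two_add_two] at h1
  have hne' : g v ≠ g (mate (p + 2) v) := g.injective.ne (mate_ne _ _).symm
  simp only [opp, hf, ← h1, mate_pairOf _ _ hne']

/-! ### Vertices -/

variable {τ}

theorem SameVertex.refl (c : Corner ι) : τ.SameVertex c c := ⟨0, rfl⟩

theorem SameVertex.trans {a b c : Corner ι} (h : τ.SameVertex a b) (h' : τ.SameVertex b c) :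
    τ.SameVertex a c := by
  obtain ⟨k, rfl⟩ := h
  obtain ⟨l, rfl⟩ := h'
  exact ⟨l + k, Function.iterate_add_apply _ _ _ _⟩

theorem sameVertex_cw (c : Corner ι) : τ.SameVertex c (τ.cw c) := ⟨1, rfl⟩

/-- The two ends of an interior edge are different vertices. Otherwise `rev` would act on the cycle
of `cw` as a reflection, which either fixes a corner (k even) or exchanges two adjacent ones (k
odd); `rev_ne` and `rev_ne_cw` exclude both. -/
theorem not_sameVertex_rev (c : Corner ι) : ¬ τ.SameVertex c (rev c) := by
  rintro ⟨k, hk⟩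
  have key : ∀ m (c : Corner ι), τ.cw^[m] (rev (τ.cw^[m] c)) = rev c := by
    intro m
    induction m with
    | zero => intro c; rfl
    | succ m ih =>
      intro c
      rw [Function.iterate_succ_apply τ.cw m (rev _), Function.iterate_succ_apply' τ.cw m c,
        cw_rev_cw, ih]
  rcases Nat.even_or_odd' k with ⟨m, rfl | rfl⟩
  · refine rev_ne (τ.cw^[m] c) (τ.cw_injective.iterate m ?_)
    rw [key, ← hk, ← Function.iterate_add_apply, two_mul]
  · refine rev_ne_cw τ (τ.cw^[m] c) (τ.cw_injective.iterate m ?_)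
    rw [key, ← hk, ← Function.iterate_succ_apply' τ.cw, ← Function.iterate_add_apply]
    congr 1; omega

section Finite

variable [Finite ι]

theorem cw_mem_periodicPts (c : Corner ι) : c ∈ Function.periodicPts τ.cw :=
  τ.cw_injective.mem_periodicPts c

theorem SameVertex.symm {a b : Corner ι} (h : τ.SameVertex a b) : τ.SameVertex b a := by
  obtain ⟨k, rfl⟩ := h
  have hp := Function.minimalPeriod_pos_of_mem_periodicPts (cw_mem_periodicPts (τ := τ) a)
  set n := Function.minimalPeriod τ.cw a with hn
  -- The k steps already made are completed to k full turns.
  refine ⟨n * k - k, ?_⟩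
  have hk : k ≤ n * k := Nat.le_mul_of_pos_left k hp
  rw [← Function.iterate_add_apply, Nat.sub_add_cancel hk]
  exact (Function.isPeriodicPt_minimalPeriod τ.cw a).mul_const k

theorem sameVertex_congr {a b c : Corner ι} (h : τ.SameVertex a b) :
    τ.SameVertex a c ↔ τ.SameVertex b c :=
  ⟨fun h' => h.symm.trans h', fun h' => h.trans h'⟩

theorem sameVertex_congr_right {a b c : Corner ι} (h : τ.SameVertex a b) :
    τ.SameVertex c a ↔ τ.SameVertex c b :=
  ⟨fun h' => h'.trans h, fun h' => h'.trans h.symm⟩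

theorem sameVertex_rev {a b : Corner ι} (h : τ.SameVertex a b) :
    τ.SameVertex (rev a) (rev b) := by
  obtain ⟨k, rfl⟩ := h
  induction k with
  | zero => exact SameVertex.refl _
  | succ k ih =>
    refine ih.trans (SameVertex.symm ⟨1, ?_⟩)
    rw [Function.iterate_succ_apply' τ.cw k, Function.iterate_one, cw_rev_cw]

end Finite

theorem injOn_iterate_cw (c : Corner ι) :
    Set.InjOn (fun k => τ.cw^[k] c) (Finset.range (Function.minimalPeriod τ.cw c)) := by
  intro a ha b hb h
  simp only [Finset.coe_range, Set.mem_Iio] at ha hb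
  exact (Function.iterate_eq_iterate_iff_of_lt_minimalPeriod ha hb).1 h

section Fintype

variable [Fintype ι]

@[simp] theorem mem_cornersAt {c c' : Corner ι} : c' ∈ τ.cornersAt c ↔ τ.SameVertex c c' := by
  simp [cornersAt]

theorem cornersAt_eq_image [DecidableEq ι] (c : Corner ι) : τ.cornersAt c =
    (Finset.range (Function.minimalPeriod τ.cw c)).image fun k => τ.cw^[k] c := by
  have hp := Function.minimalPeriod_pos_of_mem_periodicPts (cw_mem_periodicPts (τ := τ) c)
  ext c'
  simp only [mem_cornersAt, Finset.mem_image, Finset.mem_range]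
  constructor
  · rintro ⟨k, rfl⟩
    exact ⟨k % _, Nat.mod_lt _ hp, Function.iterate_mod_minimalPeriod_eq⟩
  · rintro ⟨k, -, rfl⟩
    exact ⟨k, rfl⟩

theorem degree_eq (c : Corner ι) : τ.degree c = Function.minimalPeriod τ.cw c := by
  classical
  rw [degree, cornersAt_eq_image, Finset.card_image_of_injOn (injOn_iterate_cw c),
    Finset.card_range]

theorem iterate_degree (c : Corner ι) : τ.cw^[τ.degree c] c = c := by
  rw [degree_eq]
  exact Function.isPeriodicPt_minimalPeriod τ.cw c

theorem sum_cornersAt {M : Type*} [AddCommMonoid M] (c : Corner ι) (f : Corner ι → M) :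
    ∑ c' ∈ τ.cornersAt c, f c' = ∑ k ∈ Finset.range (τ.degree c), f (τ.cw^[k] c) := by
  classical
  rw [cornersAt_eq_image, Finset.sum_image (injOn_iterate_cw c), degree_eq]

end Fintype

end IdealTriangulation

theorem basisVec_apply {ι : Type*} [DecidableEq ι] (c : Corner ι) (i : ι) (p : Fin 3) :
    basisVec c i p = if i = c.1 ∧ p = c.2.2 then 1 else 0 := by
  unfold basisVec
  congr

theorem basisVec_nonneg {ι : Type*} (c : Corner ι) (i : ι) (p : Fin 3) : 0 ≤ basisVec c i p := by
  classical
  rw [basisVec_apply]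
  split_ifs <;> simp

/-! ### Deformations along closed curves are tangent to the space of generalized angle structures.
-/

namespace IdealTriangulation

variable {ι : Type*} (τ : IdealTriangulation ι)

/-- Going along the list of sides `γ`, every triangle is left as often as it is entered. -/
def IsClosedCurve (γ : List (Side ι)) : Prop :=
  (γ.map fun s => triangle (τ.cross s)).Perm (γ.map triangle)

variable {τ}

theorem map_deformation (L : AngleVector ι →+ ℝ) (γ : List (Side ι)) :
    L (τ.deformation γ) = (γ.map fun s => L (basisVec (τ.cross s)) - L (basisVec s)).sum := by
  rw [deformation, map_list_sum, List.map_map]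
  congr 1
  refine List.map_congr_left fun s _ => ?_
  simp

theorem deformation_apply (γ : List (Side ι)) (i : ι) (p : Fin 3) :
    τ.deformation γ i p = (γ.map fun s => basisVec (τ.cross s) i p - basisVec s i p).sum :=
  map_deformation ((Pi.evalAddMonoidHom (fun _ : Fin 3 => ℝ) p).comp
    (Pi.evalAddMonoidHom (fun _ : ι => Fin 3 → ℝ) i)) γ

/-- By the hypothesis, each crossing changes `L` by the value of `C` on the triangle entered minus
its value on the triangle left. Along a closed curve these differences cancel. -/
theorem IsClosedCurve.map_deformation_eq_zero {γ : List (Side ι)} (hγ : τ.IsClosedCurve γ)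
    (L : AngleVector ι →+ ℝ) (C : CuspTriangle ι → ℝ)
    (h : ∀ s, L (basisVec (τ.cross s)) - C (triangle (τ.cross s)) =
      L (basisVec s) - C (triangle s)) :
    L (τ.deformation γ) = 0 := by
  have h1 : (γ.map fun s => L (basisVec (τ.cross s)) - L (basisVec s)) =
      γ.map fun s => C (triangle (τ.cross s)) - C (triangle s) :=
    List.map_congr_left fun s _ => by linarith [h s]
  have h2 : ∀ (f g : Side ι → ℝ) (l : List (Side ι)),
      (l.map fun s => f s - g s).sum = (l.map f).sum - (l.map g).sum := by
    intro f g l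
    induction l with
    | nil => simp
    | cons a l ih => simp [ih]; ring
  rw [map_deformation, h1, h2 (fun s => C (triangle (τ.cross s))) (fun s => C (triangle s)),
    sub_eq_zero]
  have h3 := (List.Perm.map C hγ).sum_eq
  rwa [List.map_map, List.map_map] at h3

theorem IsClosedCurve.deformation_tetrahedron {γ : List (Side ι)} (hγ : τ.IsClosedCurve γ)
    (i : ι) : τ.deformation γ i 0 + τ.deformation γ i 1 + τ.deformation γ i 2 = 0 := by
  classical
  let L : AngleVector ι →+ ℝ :=
    { toFun := fun θ => θ i 0 + θ i 1 + θ i 2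
      map_zero' := by simp
      map_add' := fun a b => by simp; ring }
  let C : CuspTriangle ι → ℝ := fun T => if i = T.1 then 1 else 0
  refine hγ.map_deformation_eq_zero L C fun s => ?_
  have h : ∀ s : Side ι, L (basisVec s) = if i = s.1 then 1 else 0 := by
    rintro ⟨j, v, p⟩
    change basisVec _ i 0 + basisVec _ i 1 + basisVec _ i 2 = _
    simp only [basisVec_apply]
    by_cases hi : i = j
    · fin_cases p <;> simp [hi]
    · simp [hi]
  have h' : ∀ s : Side ι, C (triangle s) = if i = s.1 then 1 else 0 := fun s => rfl
  rw [h, h, h', h', sub_self, sub_self]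

section Fintype

variable [Fintype ι]

/-- One coordinate of an angle vector is read at all four cusps of its tetrahedron, hence the sum
over `v`. -/
theorem sum_cornersAt_basisVec [DecidableEq (Corner ι)] (x s : Corner ι) :
    ∑ c ∈ τ.cornersAt x, basisVec s c.1 c.2.2 =
      ∑ v, if (s.1, v, s.2.2) ∈ τ.cornersAt x then (1 : ℝ) else 0 := by
  classical
  obtain ⟨i, u, p⟩ := s
  simp only [basisVec_apply]
  rw [Finset.sum_boole, Finset.sum_boole]
  congr 1
  refine Finset.card_bij' (fun c _ => c.2.1) (fun v _ => (i, v, p)) ?_ ?_ ?_ ?_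
  · rintro ⟨j, v, q⟩ h
    simp only [Finset.mem_filter] at h
    obtain ⟨h, rfl, rfl⟩ := h
    simp [mem_cornersAt.1 h]
  · intro v h
    simpa using h
  · rintro ⟨j, v, q⟩ h
    simp only [Finset.mem_filter] at h
    obtain ⟨h, rfl, rfl⟩ := h
    rfl
  · intro v h
    rfl

theorem sum_univ_mate (f : Fin 4 → ℝ) (v : Fin 4) (p : Fin 3) :
    ∑ u, f u = f v + f (mate p v) + f (mate (p + 1) v) + f (mate (p + 2) v) := by
  fin_cases v <;> fin_cases p <;> simp [Fin.sum_univ_four, mate] <;> ring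

/-- Let `e` count the ends of an edge that lie at the vertex of `x`. The angle opposite a side
contributes `e` of its own edge and of the opposite edge; subtracting `e` at the three corners of
the triangle leaves only edges of the face that contains the side. This is the same from both sides
of the face, so the potential argument applies. -/
theorem IsClosedCurve.deformation_edge {γ : List (Side ι)} (hγ : τ.IsClosedCurve γ)
    (x : Corner ι) : ∑ c ∈ τ.cornersAt x, τ.deformation γ c.1 c.2.2 = 0 := by
  classical
  let L : AngleVector ι →+ ℝ :=
    { toFun := fun θ => ∑ c ∈ τ.cornersAt x, θ c.1 c.2.2
      map_zero' := by simp
      map_add' := fun a b => by simp [Finset.sum_add_distrib] }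
  let n : Corner ι → ℝ := fun c => if c ∈ τ.cornersAt x then 1 else 0
  let e : Corner ι → ℝ := fun c => n c + n (rev c)
  have hn : ∀ c, n (τ.cw c) = n c := fun c => by
    simp only [n, mem_cornersAt, sameVertex_congr_right (sameVertex_cw c)]
  have hcw : ∀ c, e (τ.cw c) = e c := fun c => by
    simp only [e]
    rw [hn, ← hn (rev (τ.cw c)), cw_rev_cw]
  have hrev : ∀ c, e (rev c) = e c := fun c => by
    simp only [e, rev_rev]
    ring
  have hL : ∀ s, L (basisVec s) = e s + e (opp s) := by
    rintro ⟨i, v, p⟩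
    refine (sum_cornersAt_basisVec x (i, v, p)).trans ?_
    have hm : mate p (mate (p + 1) v) = mate (p + 2) v := by
      have := mate_add_two_mate (p + 1) v
      rwa [add_one_add_one, add_one_add_two] at this
    rw [sum_univ_mate _ v p]
    simp only [e, n, opp, rev, hm]
    ring
  have hC : ∀ c : Corner ι, e (c.1, c.2.1, 0) + e (c.1, c.2.1, 1) + e (c.1, c.2.1, 2) =
      e c + e (ccwAfter c) + e (ccwBefore c) := by
    rintro ⟨i, v, p⟩
    fin_cases p <;> simp [ccwAfter, ccwBefore]
    · ring
    · ring
  refine hγ.map_deformation_eq_zero L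
    (fun T => e (T.1, T.2, 0) + e (T.1, T.2, 1) + e (T.1, T.2, 2)) fun s => ?_
  have h1 : e (opp (τ.cross s)) = e (opp s) := by rw [← rev_cw_opp, hrev, hcw]
  have h2 : e (ccwBefore (τ.cross s)) = e (ccwAfter s) := by rw [← cw_ccwAfter, hcw]
  have h3 : e (ccwAfter (τ.cross s)) = e (ccwBefore s) := by rw [← cw_ccwAfter_cross, hcw]
  rw [hL, hL]
  simp only [triangle]
  rw [hC, hC, h1, h2, h3]
  ring

theorem isClosedCurve_vertexLoop (c : Corner ι) : τ.IsClosedCurve (τ.vertexLoop c) := by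
  simp only [IsClosedCurve, vertexLoop, List.map_map]
  set n := τ.degree c with hn
  have h1 : ((fun s => triangle (τ.cross s)) ∘ fun k => ccwBefore (τ.cw^[k] c)) =
      fun k => triangle (τ.cw^[k + 1] c) := by
    funext k
    rw [Function.comp_apply, Function.iterate_succ_apply', cw_eq]
    rfl
  have h2 : (triangle ∘ fun k => ccwBefore (τ.cw^[k] c)) = fun k => triangle (τ.cw^[k] c) := rfl
  rw [h1, h2]
  have h3 : triangle (τ.cw^[n] c) = triangle (τ.cw^[0] c) := by rw [hn, iterate_degree]; rfl
  have h4 : List.map (fun k => triangle (τ.cw^[k + 1] c)) (List.range n) ++ [triangle (τ.cw^[0] c)]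
      |>.Perm (List.map (fun k => triangle (τ.cw^[k] c)) (List.range n) ++
        [triangle (τ.cw^[n] c)]) := by
    have e1 := List.range_succ_eq_map (n := n)
    have e2 := List.range_succ (n := n)
    have e3 : List.map (fun k => triangle (τ.cw^[k] c)) (List.range n) ++ [triangle (τ.cw^[n] c)] =
        List.map (fun k => triangle (τ.cw^[k] c)) (List.range (n + 1)) := by
      rw [e2]; simp
    rw [e3, e1]
    simp only [List.map_cons, List.map_map]
    exact List.perm_append_singleton _ _
  rw [h3] at h4
  exact (List.perm_append_right_iff _).1 h4

end Fintype

end IdealTriangulation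

/-! ### Taut structures: one wide corner in each cusp triangle, two at each vertex. -/

namespace IdealTriangulation

variable {ι : Type*} {τ : IdealTriangulation ι} {θ : AngleVector ι}

section Taut

variable [Fintype ι]

theorem IsTaut.apply_eq (h : τ.IsTaut θ) (i : ι) (p : Fin 3) :
    θ i p = if p = widePair θ i then Real.pi else 0 := by
  have hs := h.1.tetrahedron i
  have h0 := h.2 i 0
  have h1 := h.2 i 1
  have h2 := h.2 i 2
  have hpi := Real.pi_pos
  have hne := Real.pi_ne_zero
  have hne' := Real.pi_ne_zero.symm
  unfold widePair
  rcases h0 with h0 | h0 <;> rcases h1 with h1 | h1 <;> rcases h2 with h2 | h2 <;>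
    rw [h0, h1, h2] at hs <;> first
    | (exfalso; linarith)
    | (fin_cases p <;> simp [h0, h1, h2, hne'])

theorem IsTaut.wide_iff (h : τ.IsTaut θ) (c : Corner ι) :
    Wide θ c ↔ c.2.2 = widePair θ c.1 := by
  rw [Wide, h.apply_eq]
  split_ifs with hc
  · simp [hc]
  · simp [hc, Real.pi_ne_zero.symm]

theorem IsTaut.thin_iff (h : τ.IsTaut θ) (c : Corner ι) :
    Thin θ c ↔ c.2.2 ≠ widePair θ c.1 := by
  rw [Thin, h.apply_eq]
  split_ifs with hc
  · simp [hc, Real.pi_ne_zero]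
  · simp [hc]

theorem IsTaut.thin_iff_not_wide (h : τ.IsTaut θ) (c : Corner ι) : Thin θ c ↔ ¬ Wide θ c := by
  rw [h.thin_iff, h.wide_iff]

/-- There are two wide corners at each vertex. -/
theorem IsTaut.card_wide [DecidablePred (Wide θ)] (h : τ.IsTaut θ) (c : Corner ι) :
    ((τ.cornersAt c).filter (Wide θ)).card = 2 := by
  have h1 := h.1.edge c
  have h2 : ∑ c' ∈ τ.cornersAt c, θ c'.1 c'.2.2 =
      ∑ c' ∈ τ.cornersAt c, if Wide θ c' then Real.pi else 0 := by
    refine Finset.sum_congr rfl fun c' _ => ?_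
    by_cases hw : Wide θ c'
    · rw [if_pos hw]; exact hw
    · rw [if_neg hw]; exact (h.thin_iff_not_wide c').2 hw
  rw [h2, ← Finset.sum_filter, Finset.sum_const, nsmul_eq_mul] at h1
  exact_mod_cast mul_right_cancel₀ Real.pi_ne_zero h1

theorem IsTaut.exists_wide (h : τ.IsTaut θ) (c : Corner ι) :
    ∃ c', τ.SameVertex c c' ∧ Wide θ c' := by
  classical
  have h1 := h.card_wide c
  obtain ⟨c', hc'⟩ := Finset.card_pos.1 (h1 ▸ two_pos : 0 < ((τ.cornersAt c).filter (Wide θ)).card)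
  rw [Finset.mem_filter, mem_cornersAt] at hc'
  exact ⟨c', hc'⟩

/-- Among three wide corners at a vertex, two coincide. -/
theorem IsTaut.wide_eq (h : τ.IsTaut θ) {a b c : Corner ι} (hab : τ.SameVertex a b)
    (hac : τ.SameVertex a c) (ha : Wide θ a) (hb : Wide θ b) (hc : Wide θ c) (hab' : a ≠ b)
    (hac' : a ≠ c) : b = c := by
  classical
  by_contra hbc
  have h1 := h.card_wide a
  have h2 : ({a, b, c} : Finset (Corner ι)) ⊆ (τ.cornersAt a).filter (Wide θ) := by
    intro x hx
    simp only [Finset.mem_insert, Finset.mem_singleton] at hx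
    rw [Finset.mem_filter, mem_cornersAt]
    rcases hx with rfl | rfl | rfl
    · exact ⟨SameVertex.refl _, ha⟩
    · exact ⟨hab, hb⟩
    · exact ⟨hac, hc⟩
  have h3 := Finset.card_le_card h2
  rw [Finset.card_eq_three.2 ⟨a, b, c, hab', hac', hbc, rfl⟩] at h3
  omega

end Taut

/-! ### Colours -/

/-- The wide corner of a cusp triangle. -/
noncomputable def wideCorner (θ : AngleVector ι) (T : CuspTriangle ι) : Corner ι := (T.1, T.2, widePair θ T.1)

/-- The thin corner of a cusp triangle that lies at a blue vertex (`b = true`) or at a red vertex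
(`b = false`). -/
noncomputable def thinCorner (θ : AngleVector ι) (b : Bool) (T : CuspTriangle ι) : Corner ι :=
  (T.1, T.2, widePair θ T.1 + if b then 1 else 2)

@[simp] theorem ccwAfter_wideCorner (T : CuspTriangle ι) :
    ccwAfter (wideCorner θ T) = thinCorner θ true T := by
  simp [ccwAfter, wideCorner, thinCorner]

@[simp] theorem ccwBefore_wideCorner (T : CuspTriangle ι) :
    ccwBefore (wideCorner θ T) = thinCorner θ false T := by
  simp [ccwBefore, wideCorner, thinCorner]

@[simp] theorem ccwAfter_thinCorner_true (T : CuspTriangle ι) :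
    ccwAfter (thinCorner θ true T) = thinCorner θ false T := by
  simp [ccwAfter, thinCorner, add_one_add_one]

@[simp] theorem ccwBefore_thinCorner_true (T : CuspTriangle ι) :
    ccwBefore (thinCorner θ true T) = wideCorner θ T := by
  simp [ccwBefore, thinCorner, wideCorner, add_one_add_two]

@[simp] theorem ccwAfter_thinCorner_false (T : CuspTriangle ι) :
    ccwAfter (thinCorner θ false T) = wideCorner θ T := by
  simp [ccwAfter, thinCorner, wideCorner, add_two_add_one]

@[simp] theorem ccwBefore_thinCorner_false (T : CuspTriangle ι) :
    ccwBefore (thinCorner θ false T) = thinCorner θ true T := by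
  simp [ccwBefore, thinCorner, add_two_add_two]

@[simp] theorem triangle_wideCorner (T : CuspTriangle ι) : triangle (wideCorner θ T) = T := rfl

@[simp] theorem triangle_thinCorner (b : Bool) (T : CuspTriangle ι) :
    triangle (thinCorner θ b T) = T := rfl

theorem wideCorner_injective : Function.Injective (wideCorner θ) := fun _ _ h => by
  simpa using congrArg triangle h

theorem eq_wideCorner_or (θ : AngleVector ι) (c : Corner ι) :
    c = wideCorner θ (triangle c) ∨ c = thinCorner θ true (triangle c) ∨
      c = thinCorner θ false (triangle c) := by
  obtain ⟨i, v, p⟩ := c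
  simp only [wideCorner, thinCorner, triangle, Prod.mk.injEq, true_and]
  generalize widePair θ i = w
  revert p w
  decide

theorem thinCorner_ne_wideCorner (b : Bool) (T T' : CuspTriangle ι) :
    thinCorner θ b T ≠ wideCorner θ T' := by
  intro h
  have h1 := congrArg triangle h
  simp only [triangle_thinCorner, triangle_wideCorner] at h1
  subst h1
  simp only [thinCorner, wideCorner, Prod.mk.injEq, true_and] at h
  revert h
  generalize widePair θ T.1 = w
  revert w b
  decide

theorem thinCorner_true_ne_false (T T' : CuspTriangle ι) :
    thinCorner θ true T ≠ thinCorner θ false T' := by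
  intro h
  have h1 := congrArg triangle h
  simp only [triangle_thinCorner] at h1
  subst h1
  simp only [thinCorner, Prod.mk.injEq, true_and] at h
  revert h
  generalize widePair θ T.1 = w
  revert w
  decide

variable (τ θ) in
open Classical in
/-- The colour of the vertex at a corner: `true` for blue and `false` for red. -/
noncomputable def colour (c : Corner ι) : Bool := decide (τ.Blue θ c)

theorem colour_eq_true {c : Corner ι} : τ.colour θ c = true ↔ τ.Blue θ c := by
  simp [colour]

section Veering

variable [Fintype ι]

theorem IsTaut.wide_wideCorner (h : τ.IsTaut θ) (T : CuspTriangle ι) : Wide θ (wideCorner θ T) :=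
  (h.wide_iff _).2 rfl

theorem IsTaut.thin_thinCorner (h : τ.IsTaut θ) (b : Bool) (T : CuspTriangle ι) :
    Thin θ (thinCorner θ b T) := by
  rw [h.thin_iff]
  exact fun hc => thinCorner_ne_wideCorner b T T (by
    simp only [thinCorner, wideCorner, Prod.mk.injEq, true_and]; exact hc)

theorem IsTaut.wide_iff_eq_wideCorner (h : τ.IsTaut θ) (c : Corner ι) :
    Wide θ c ↔ c = wideCorner θ (triangle c) := by
  rw [h.wide_iff]
  obtain ⟨i, v, p⟩ := c
  simp [wideCorner, triangle]

theorem Blue.congr {a b : Corner ι} (hab : τ.SameVertex a b) : τ.Blue θ a ↔ τ.Blue θ b := by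
  simp only [Blue, sameVertex_congr hab]

theorem Red.congr {a b : Corner ι} (hab : τ.SameVertex a b) : τ.Red θ a ↔ τ.Red θ b := by
  simp only [Red, sameVertex_congr hab]

theorem IsTaut.not_red_thinCorner (h : τ.IsTaut θ) (T : CuspTriangle ι) :
    ¬ τ.Red θ (thinCorner θ true T) := by
  intro hr
  have h1 := hr _ (SameVertex.refl _) (h.thin_thinCorner true T)
  rw [ccwAfter_thinCorner_true, ← not_not (a := Wide θ _), ← h.thin_iff_not_wide] at h1
  exact h1 (h.thin_thinCorner false T)

theorem IsTaut.not_blue_thinCorner (h : τ.IsTaut θ) (T : CuspTriangle ι) :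
    ¬ τ.Blue θ (thinCorner θ false T) := by
  intro hr
  have h1 := hr _ (SameVertex.refl _) (h.thin_thinCorner false T)
  rw [ccwBefore_thinCorner_false, ← not_not (a := Wide θ _), ← h.thin_iff_not_wide] at h1
  exact h1 (h.thin_thinCorner true T)

theorem IsVeering.blue_thinCorner (h : τ.IsVeering θ) (T : CuspTriangle ι) :
    τ.Blue θ (thinCorner θ true T) :=
  (h.2 _).resolve_right (h.1.not_red_thinCorner T)

theorem IsVeering.red_thinCorner (h : τ.IsVeering θ) (T : CuspTriangle ι) :
    τ.Red θ (thinCorner θ false T) :=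
  (h.2 _).resolve_left (h.1.not_blue_thinCorner T)

/-- Fans are not empty. -/
theorem IsVeering.thin_cw (h : τ.IsVeering θ) (T : CuspTriangle ι) :
    Thin θ (τ.cw (wideCorner θ T)) := by
  rw [h.1.thin_iff_not_wide]
  intro hw
  -- If two wide corners were adjacent, the other end of the segment between them would be a blue
  -- thin corner of one triangle and a red thin corner of the other.
  set s := thinCorner θ false T with hs
  have hc : wideCorner θ T = ccwAfter s := by simp [hs]
  rw [hc, cw_ccwAfter, h.1.wide_iff_eq_wideCorner] at hw
  set S := triangle (ccwBefore (τ.cross s))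
  have h1 : ccwAfter (τ.cross s) = thinCorner θ false S := by
    have := congrArg (fun c => ccwAfter (ccwAfter c)) hw
    simpa using this
  have h2 := cw_ccwAfter_cross τ s
  have h3 := sameVertex_cw (τ := τ) (ccwAfter (τ.cross s))
  rw [h2, h1, hs, ccwBefore_thinCorner_false] at h3
  exact h.1.not_blue_thinCorner S ((Blue.congr h3).2 (h.blue_thinCorner T))

/-- Both colours quantify over the thin corners at the vertex and would hold together if there were
none; a nonempty fan provides one, and its position in its triangle decides the colour. -/
theorem IsVeering.not_blue_and_red (h : τ.IsVeering θ) (c : Corner ι) :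
    ¬ (τ.Blue θ c ∧ τ.Red θ c) := by
  rintro ⟨hb, hr⟩
  obtain ⟨c', hc, hw⟩ := h.1.exists_wide c
  rw [h.1.wide_iff_eq_wideCorner] at hw
  have ht := h.thin_cw (triangle c')
  rw [← hw] at ht
  have hc2 := hc.trans (sameVertex_cw c')
  rcases eq_wideCorner_or θ (τ.cw c') with h1 | h1 | h1
  · rw [h.1.thin_iff_not_wide] at ht
    exact ht ((h.1.wide_iff_eq_wideCorner _).2 h1)
  · rw [h1] at hc2
    exact h.1.not_red_thinCorner _ ((Red.congr hc2).1 hr)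
  · rw [h1] at hc2
    exact h.1.not_blue_thinCorner _ ((Blue.congr hc2).1 hb)

theorem IsVeering.red_iff (h : τ.IsVeering θ) (c : Corner ι) : τ.Red θ c ↔ ¬ τ.Blue θ c :=
  ⟨fun hr hb => h.not_blue_and_red c ⟨hb, hr⟩, fun hb => (h.2 c).resolve_left hb⟩

theorem IsVeering.colour_eq_false (h : τ.IsVeering θ) {c : Corner ι} :
    τ.colour θ c = false ↔ τ.Red θ c := by
  simp [colour, h.red_iff]

theorem colour_congr {a b : Corner ι} (hab : τ.SameVertex a b) : τ.colour θ a = τ.colour θ b := by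
  rw [Bool.eq_iff_iff, colour_eq_true, colour_eq_true, Blue.congr hab]

theorem colour_cw (c : Corner ι) : τ.colour θ (τ.cw c) = τ.colour θ c :=
  (colour_congr (sameVertex_cw c)).symm

/-- Being wide or thin depends only on the tetrahedron and the pair of edges, not on the preferred
end, so both ends of an edge satisfy the same conditions. -/
theorem colour_rev (c : Corner ι) : τ.colour θ (rev c) = τ.colour θ c := by
  have key : ∀ c, τ.Blue θ c → τ.Blue θ (rev c) := by
    intro c hc c' hcc ht
    have h1 := hc (rev c') (by simpa using sameVertex_rev hcc) ht
    exact h1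
  rw [Bool.eq_iff_iff, colour_eq_true, colour_eq_true]
  exact ⟨fun h => by simpa using key _ h, key c⟩

theorem IsVeering.colour_thinCorner (h : τ.IsVeering θ) (b : Bool) (T : CuspTriangle ι) :
    τ.colour θ (thinCorner θ b T) = b := by
  cases b
  · exact h.colour_eq_false.2 (h.red_thinCorner T)
  · exact colour_eq_true.2 (h.blue_thinCorner T)

end Veering

end IdealTriangulation

theorem eq_or_eq_mate : ∀ (p : Fin 3) (v u : Fin 4),
    u = v ∨ u = mate p v ∨ u = mate (p + 1) v ∨ u = mate (p + 2) v := by decide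

/-! ### Ladders: neighbours across the base and across the ladderpole side. -/

namespace IdealTriangulation

variable {ι : Type*} {τ : IdealTriangulation ι} {θ : AngleVector ι}

variable (τ θ) in
/-- The colour of the vertex at the wide corner of a cusp triangle. -/
noncomputable def wideColour (T : CuspTriangle ι) : Bool := τ.colour θ (wideCorner θ T)

variable (τ θ) in
/-- The cusp triangle adjacent to `T` along its ladderpole side. -/
noncomputable def acrossPole (T : CuspTriangle ι) : CuspTriangle ι :=
  triangle (τ.cross (τ.poleSide θ T))

theorem IsTransverseTaut.out_cross {out : ι → Fin 4 → Bool} (ht : τ.IsTransverseTaut θ out)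
    (s : Side ι) :
    out (τ.cross s).1 (mate (τ.cross s).2.2 (τ.cross s).2.1) = !out s.1 (mate s.2.2 s.2.1) := by
  obtain ⟨i, v, p⟩ := s
  have hv : τ.glue i (mate p v) v ≠ τ.glue i (mate p v) (mate p v) := fun h =>
    mate_ne p v ((τ.glue i (mate p v)).injective h).symm
  simp only [cross, mate_pairOf _ _ hv]
  exact ht.1 i (mate p v)

section Veering

variable [Fintype ι]

theorem colour_ccwBefore_cross (s : Side ι) :
    τ.colour θ (ccwBefore (τ.cross s)) = τ.colour θ (ccwAfter s) := by
  rw [← cw_ccwAfter, colour_cw]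

theorem colour_ccwAfter_cross (s : Side ι) :
    τ.colour θ (ccwAfter (τ.cross s)) = τ.colour θ (ccwBefore s) := by
  rw [← cw_ccwAfter_cross, colour_cw]

/-- The base of a triangle is the upper rung (in an ascending ladder) of the next triangle. -/
theorem IsVeering.cross_wideCorner (h : τ.IsVeering θ) (T : CuspTriangle ι) :
    τ.cross (wideCorner θ T) =
      thinCorner θ (τ.wideColour θ (τ.acrossBase θ T)) (τ.acrossBase θ T) := by
  set s := wideCorner θ T with hs
  have hT : τ.acrossBase θ T = triangle (τ.cross s) := rfl
  have h1 := colour_ccwBefore_cross (τ := τ) (θ := θ) s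
  have h2 := colour_ccwAfter_cross (τ := τ) (θ := θ) s
  rw [hs, ccwAfter_wideCorner, h.colour_thinCorner, ← hs] at h1
  rw [hs, ccwBefore_wideCorner, h.colour_thinCorner, ← hs] at h2
  rw [hT]
  -- A base runs between a blue and a red vertex. Seen from the other side their order is reversed,
  -- so the segment cannot be a base there as well, and the colours of its ends tell which of the
  -- two other sides it is.
  rcases eq_wideCorner_or θ (τ.cross s) with hc | hc | hc <;>
    generalize triangle (τ.cross s) = S at * <;> rw [hc] at h1 h2 ⊢
  · rw [ccwBefore_wideCorner, h.colour_thinCorner] at h1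
    simp at h1
  · rw [ccwBefore_thinCorner_true] at h1
    rw [wideColour, h1]
  · rw [ccwAfter_thinCorner_false] at h2
    rw [wideColour, h2]

theorem IsVeering.isLadderpole_iff_colour (h : τ.IsVeering θ) (s : Side ι) :
    τ.IsLadderpole θ s ↔ τ.colour θ (ccwAfter s) = τ.colour θ (ccwBefore s) := by
  simp only [IsLadderpole, ← colour_eq_true, ← h.colour_eq_false]
  cases τ.colour θ (ccwAfter s) <;> cases τ.colour θ (ccwBefore s) <;> simp

theorem IsVeering.isLadderpole_cross (h : τ.IsVeering θ) (s : Side ι) :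
    τ.IsLadderpole θ (τ.cross s) ↔ τ.IsLadderpole θ s := by
  rw [h.isLadderpole_iff_colour, h.isLadderpole_iff_colour, colour_ccwBefore_cross,
    colour_ccwAfter_cross]
  exact eq_comm

theorem IsVeering.isLadderpole_iff (h : τ.IsVeering θ) (s : Side ι) :
    τ.IsLadderpole θ s ↔ s = thinCorner θ (!τ.wideColour θ (triangle s)) (triangle s) := by
  rw [h.isLadderpole_iff_colour]
  rcases eq_wideCorner_or θ s with hc | hc | hc <;> generalize triangle s = S at * <;>
    subst hc
  · simp [h.colour_thinCorner, (thinCorner_ne_wideCorner _ _ _).symm]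
  · simp only [ccwAfter_thinCorner_true, h.colour_thinCorner, ccwBefore_thinCorner_true]
    change _ = τ.wideColour θ S ↔ _
    cases τ.wideColour θ S <;> simp [thinCorner_true_ne_false]
  · simp only [ccwAfter_thinCorner_false, h.colour_thinCorner, ccwBefore_thinCorner_false]
    change τ.wideColour θ S = _ ↔ _
    cases τ.wideColour θ S <;> simp [(thinCorner_true_ne_false _ _).symm]

/-- The thin corners have different colours, so the ladderpole side joins the wide corner to the
thin corner of its colour and is opposite the other thin corner. -/
theorem IsVeering.poleSide_eq (h : τ.IsVeering θ) (T : CuspTriangle ι) :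
    τ.poleSide θ T = thinCorner θ (!τ.wideColour θ T) T := by
  have key : ∀ p, τ.IsLadderpole θ (T.1, T.2, p) ↔
      (T.1, T.2, p) = thinCorner θ (!τ.wideColour θ T) T := fun p => h.isLadderpole_iff _
  obtain ⟨q, hq⟩ : ∃ q, thinCorner θ (!τ.wideColour θ T) T = (T.1, T.2, q) := ⟨_, rfl⟩
  simp only [hq, Prod.mk.injEq, true_and] at key
  unfold poleSide
  rw [hq]
  simp only [key]
  fin_cases q <;> simp

theorem IsVeering.isLadderpole_poleSide (h : τ.IsVeering θ) (T : CuspTriangle ι) :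
    τ.IsLadderpole θ (τ.poleSide θ T) := by
  rw [h.isLadderpole_iff, h.poleSide_eq, triangle_thinCorner]

theorem IsVeering.eq_poleSide (h : τ.IsVeering θ) {s : Side ι} (hs : τ.IsLadderpole θ s) :
    s = τ.poleSide θ (triangle s) := by
  rw [h.poleSide_eq]
  exact (h.isLadderpole_iff s).1 hs

theorem IsVeering.cross_poleSide (h : τ.IsVeering θ) (T : CuspTriangle ι) :
    τ.cross (τ.poleSide θ T) = τ.poleSide θ (τ.acrossPole θ T) :=
  h.eq_poleSide ((h.isLadderpole_cross _).2 (h.isLadderpole_poleSide T))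

theorem IsVeering.triangle_poleSide (h : τ.IsVeering θ) (T : CuspTriangle ι) :
    triangle (τ.poleSide θ T) = T := by
  rw [h.poleSide_eq, triangle_thinCorner]

theorem IsVeering.acrossPole_acrossPole (h : τ.IsVeering θ) (T : CuspTriangle ι) :
    τ.acrossPole θ (τ.acrossPole θ T) = T := by
  rw [acrossPole, ← h.cross_poleSide, cross_cross, h.triangle_poleSide]

theorem IsVeering.colour_ccwAfter_poleSide (h : τ.IsVeering θ) (T : CuspTriangle ι) :
    τ.colour θ (ccwAfter (τ.poleSide θ T)) = τ.wideColour θ T := by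
  rw [h.poleSide_eq]
  cases hX : τ.wideColour θ T
  · simp [h.colour_thinCorner]
  · simpa [wideColour] using hX

theorem IsVeering.colour_ccwBefore_poleSide (h : τ.IsVeering θ) (T : CuspTriangle ι) :
    τ.colour θ (ccwBefore (τ.poleSide θ T)) = τ.wideColour θ T := by
  rw [h.poleSide_eq]
  cases hX : τ.wideColour θ T
  · simpa [wideColour] using hX
  · simp [h.colour_thinCorner]

theorem IsVeering.wideColour_acrossPole (h : τ.IsVeering θ) (T : CuspTriangle ι) :
    τ.wideColour θ (τ.acrossPole θ T) = τ.wideColour θ T := by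
  rw [← h.colour_ccwBefore_poleSide, ← h.cross_poleSide, colour_ccwBefore_cross,
    h.colour_ccwAfter_poleSide]

theorem IsVeering.acrossBase_injective (h : τ.IsVeering θ) :
    Function.Injective (τ.acrossBase θ) := by
  intro T T' hT
  have h1 := h.cross_wideCorner T
  rw [hT, ← h.cross_wideCorner T'] at h1
  exact wideCorner_injective (τ.cross_injective h1)

/-! ### Rotating about a vertex -/

variable (τ) in
/-- Clockwise rotation about the blue vertices and counterclockwise rotation about the red ones:
in this direction a fan is traversed in the order given by `acrossBase`. -/
def rotate (b : Bool) : Equiv.Perm (Corner ι) := if b then τ.cwPerm else τ.cwPerm⁻¹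

/-- From a thin corner the rotation leaves through the base and goes along the ladder. The fan ends
at the first triangle whose wide corner has the colour of the vertex. -/
theorem IsVeering.rotate_thinCorner (h : τ.IsVeering θ) (b : Bool) (T : CuspTriangle ι) :
    τ.rotate b (thinCorner θ b T) =
      if τ.wideColour θ (τ.acrossBase θ T) = b then wideCorner θ (τ.acrossBase θ T)
      else thinCorner θ b (τ.acrossBase θ T) := by
  have h1 := cw_ccwAfter τ (wideCorner θ T)
  have h2 := cw_ccwAfter_cross τ (wideCorner θ T)
  rw [h.cross_wideCorner] at h1 h2
  generalize τ.acrossBase θ T = S at *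
  cases b
  · simp only [rotate, Bool.false_eq_true, if_false, Equiv.Perm.inv_eq_iff_eq, cwPerm_apply]
    cases hX : τ.wideColour θ S <;> simp [hX] at h2 ⊢ <;> exact h2.symm
  · simp only [rotate, if_true, cwPerm_apply]
    cases hX : τ.wideColour θ S <;> simp [hX] at h1 ⊢ <;> exact h1

/-- From a wide corner the rotation leaves through the ladderpole side. With `rotate_thinCorner`
this describes the whole link of a vertex: two fans, one in each of the two ladders along the pole.
-/
theorem IsVeering.rotate_wideCorner (h : τ.IsVeering θ) (T : CuspTriangle ι) :
    τ.rotate (τ.wideColour θ T) (wideCorner θ T) =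
      thinCorner θ (τ.wideColour θ T) (τ.acrossPole θ T) := by
  have h1 := cw_ccwAfter τ (τ.poleSide θ T)
  have h2 := cw_ccwAfter_cross τ (τ.poleSide θ T)
  rw [h.cross_poleSide, h.poleSide_eq, h.poleSide_eq, h.wideColour_acrossPole] at h1 h2
  cases hX : τ.wideColour θ T <;> simp [hX] at h1 h2
  · simp only [rotate, Bool.false_eq_true, if_false, Equiv.Perm.inv_eq_iff_eq, cwPerm_apply, h2]
  · simp only [rotate, if_true, cwPerm_apply, h1]

theorem sameVertex_rotate (b : Bool) (c : Corner ι) : τ.SameVertex c (τ.rotate b c) := by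
  cases b
  · refine SameVertex.symm ⟨1, ?_⟩
    change τ.cwPerm (τ.cwPerm⁻¹ c) = c
    simp
  · exact sameVertex_cw c

theorem SameVertex.exists_rotate_pow (b : Bool) {c c' : Corner ι} (h : τ.SameVertex c c') :
    ∃ k : ℕ, (τ.rotate b)^[k] c = c' := by
  cases b
  · obtain ⟨k, hk⟩ := h.symm
    refine ⟨k, ?_⟩
    rw [← hk]
    refine Function.LeftInverse.iterate (f := τ.cw) ?_ k c'
    intro x
    exact τ.cwPerm.symm_apply_apply x
  · exact h

/-! ### Hinges -/

theorem wideColour_mate (i : ι) (v : Fin 4) :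
    τ.wideColour θ (i, mate (widePair θ i) v) = τ.wideColour θ (i, v) :=
  colour_rev (wideCorner θ (i, v))

theorem wideColour_mate_add_two (i : ι) (v : Fin 4) :
    τ.wideColour θ (i, mate (widePair θ i + 2) v) =
      τ.wideColour θ (i, mate (widePair θ i + 1) v) := by
  rw [← wideColour_mate i (mate (widePair θ i + 2) v)]
  congr 2
  have : ∀ (p : Fin 3) (v : Fin 4), mate p (mate (p + 2) v) = mate (p + 1) v := by decide
  exact this _ _

/-- The wide edge not at `v` lies in the face of the base. Seen from the next triangle, it is
opposite the edge of a thin corner whose colour is the wide colour there, and the two edges of a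
thin pair have the same colour. -/
theorem IsVeering.wideColour_acrossBase (h : τ.IsVeering θ) (i : ι) (v : Fin 4) :
    τ.wideColour θ (τ.acrossBase θ (i, v)) =
      τ.wideColour θ (i, mate (widePair θ i + 1) v) := by
  have h1 : τ.colour θ (opp (τ.cross (wideCorner θ (i, v)))) =
      τ.colour θ (opp (wideCorner θ (i, v))) := by
    rw [← rev_cw_opp, colour_rev, colour_cw]
  have h2 : ∀ b T, ∃ T', opp (thinCorner θ b T) = thinCorner θ b T' :=
    fun b T => ⟨(T.1, mate (widePair θ T.1 + (if b then 1 else 2) + 1) T.2), rfl⟩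
  rw [h.cross_wideCorner] at h1
  obtain ⟨T', hT'⟩ := h2 (τ.wideColour θ (τ.acrossBase θ (i, v))) (τ.acrossBase θ (i, v))
  rw [hT', h.colour_thinCorner] at h1
  exact h1

/-- The wide colour beyond the base is that of the second wide edge of the tetrahedron, so hinges
are the places where the wide colour changes along a ladder. -/
theorem IsVeering.isHinge_iff (h : τ.IsVeering θ) (T : CuspTriangle ι) :
    τ.IsHinge θ T.1 ↔ τ.wideColour θ (τ.acrossBase θ T) ≠ τ.wideColour θ T := by
  obtain ⟨i, v⟩ := T
  rw [h.wideColour_acrossBase]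
  have h1 : τ.IsHinge θ i ↔
      ∃ u u', τ.wideColour θ (i, u) = true ∧ τ.wideColour θ (i, u') = false := by
    simp only [IsHinge, wideColour, colour_eq_true, h.colour_eq_false, wideCorner]
  rw [h1]
  have h2 := wideColour_mate (τ := τ) (θ := θ) i v
  have h3 := wideColour_mate_add_two (τ := τ) (θ := θ) i v
  constructor
  · rintro ⟨u, u', hu, hu'⟩ heq
    have h4 : ∀ u, τ.wideColour θ (i, u) = τ.wideColour θ (i, v) := by
      intro u
      rcases eq_or_eq_mate (widePair θ i) v u with rfl | rfl | rfl | rfl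
      · rfl
      · exact h2
      · exact heq
      · exact h3.trans heq
    rw [h4] at hu hu'
    rw [hu] at hu'
    simp at hu'
  · intro hne
    cases hX : τ.wideColour θ (i, v)
    · exact ⟨_, v, by simpa [hX] using hne, hX⟩
    · exact ⟨v, _, hX, by simpa [hX] using hne⟩

/-- In a tetrahedron that is not a hinge all wide corners have the same colour. -/
theorem IsVeering.wideColour_eq_of_not_isHinge (h : τ.IsVeering θ) {i : ι}
    (hi : ¬ τ.IsHinge θ i) (u v : Fin 4) : τ.wideColour θ (i, u) = τ.wideColour θ (i, v) := by
  by_contra hne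
  refine hi ?_
  cases hX : τ.wideColour θ (i, v)
  · have hu : τ.wideColour θ (i, u) = true := by simpa [hX] using hne
    exact ⟨u, v, colour_eq_true.1 hu, h.colour_eq_false.1 hX⟩
  · have hu : τ.wideColour θ (i, u) = false := by simpa [hX] using hne
    exact ⟨v, u, colour_eq_true.1 hX, h.colour_eq_false.1 hu⟩

/-! ### Transverse orientation -/

variable {out : ι → Fin 4 → Bool}

theorem IsTransverseTaut.out_thinCorner (ht : τ.IsTransverseTaut θ out) (h : τ.IsTaut θ)
    (b : Bool) (T : CuspTriangle ι) :
    out T.1 (mate (widePair θ T.1 + if b then 1 else 2) T.2) =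
      !out T.1 (mate (widePair θ T.1) T.2) := by
  obtain ⟨i, v⟩ := T
  refine (ht.2 i (widePair θ i) (h.wide_wideCorner (i, v)) (mate (widePair θ i) v)).2 _ ?_ ?_
  · intro hc
    exact (h.thin_iff _).1 (h.thin_thinCorner b (i, v)) (mate_injective_left _ _ _ hc)
  · rw [mate_mate]
    exact mate_ne _ _

/-- One leaves through a base and enters through a side that is not one. Crossing a face flips
`out`, passing from such a side to the base flips it again, and the two flips cancel. -/
theorem IsTransverseTaut.isAscending_acrossBase (ht : τ.IsTransverseTaut θ out)
    (h : τ.IsVeering θ) (T : CuspTriangle ι) :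
    IsAscending θ out (τ.acrossBase θ T) ↔ IsAscending θ out T := by
  have h1 := ht.out_cross (wideCorner θ T)
  rw [h.cross_wideCorner] at h1
  have h2 := ht.out_thinCorner h.1 (τ.wideColour θ (τ.acrossBase θ T)) (τ.acrossBase θ T)
  have h3 := h2.symm.trans h1
  simp only [IsAscending]
  rw [Bool.not_inj_iff] at h3
  rw [h3]
  rfl

/-- On both sides the segment is not a base, so the flip due to the crossing is the only one that
survives. -/
theorem IsTransverseTaut.isAscending_acrossPole (ht : τ.IsTransverseTaut θ out)
    (h : τ.IsVeering θ) (T : CuspTriangle ι) :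
    IsAscending θ out (τ.acrossPole θ T) ↔ ¬ IsAscending θ out T := by
  have h1 := ht.out_cross (τ.poleSide θ T)
  rw [h.cross_poleSide, h.poleSide_eq, h.poleSide_eq] at h1
  have h2 := ht.out_thinCorner h.1 (!τ.wideColour θ (τ.acrossPole θ T)) (τ.acrossPole θ T)
  have h3 := ht.out_thinCorner h.1 (!τ.wideColour θ T) T
  have h4 := h2.symm.trans (h1.trans (congrArg _ h3))
  simp only [IsAscending]
  rw [Bool.not_inj_iff] at h4
  rw [h4]
  simp

theorem IsTransverseTaut.isAscending_mate (ht : τ.IsTransverseTaut θ out)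
    (h : τ.IsTaut θ) (i : ι) (v : Fin 4) :
    IsAscending θ out (i, mate (widePair θ i) v) ↔ IsAscending θ out (i, v) := by
  have := (ht.2 i (widePair θ i) (h.wide_wideCorner (i, v)) (mate (widePair θ i) v)).1
  simp only [IsAscending]
  rw [this]

theorem IsTransverseTaut.isAscending_mate_add (ht : τ.IsTransverseTaut θ out)
    (h : τ.IsTaut θ) (i : ι) (v : Fin 4) (b : Bool) :
    IsAscending θ out (i, mate (widePair θ i + if b then 1 else 2) v) ↔
      ¬ IsAscending θ out (i, v) := by
  set w := widePair θ i with hw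
  have h1 := (ht.2 i w (h.wide_wideCorner (i, v)) (mate w v)).2
    (mate w (mate (w + if b then 1 else 2) v))
  have h2 : ∀ (w : Fin 3) (b : Bool) (v : Fin 4),
      mate w (mate (w + if b then 1 else 2) v) ≠ mate w v ∧
      mate w (mate (w + if b then 1 else 2) v) ≠ mate w (mate w v) := by decide
  have h3 := h1 (h2 _ _ _).1 (h2 _ _ _).2
  simp only [IsAscending, ← hw, h3]
  simp

end Veering

end IdealTriangulation

namespace IdealTriangulation

variable {ι : Type*} {τ : IdealTriangulation ι} {θ : AngleVector ι}

/-! ### Fans -/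

theorem le_fanLength {c : Corner ι} {m n : ℕ} (hn : Wide θ (τ.cw^[n + 1] c))
    (h : ∀ k < m, ¬ Wide θ (τ.cw^[k + 1] c)) : m ≤ τ.fanLength θ c := by
  have h1 : τ.fanLength θ c ∈ {k | Wide θ (τ.cw^[k + 1] c)} := Nat.sInf_mem ⟨n, hn⟩
  by_contra hlt
  exact h _ (not_le.1 hlt) h1

theorem cw_iterate_rotate_false (k n : ℕ) (c : Corner ι) :
    τ.cw^[k] ((τ.rotate false)^[k + n] c) = (τ.rotate false)^[n] c := by
  rw [Function.iterate_add_apply]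
  refine Function.LeftInverse.iterate (f := τ.rotate false) (g := τ.cw) ?_ k _
  intro x
  exact τ.cwPerm.apply_symm_apply x

theorem not_isHinge_of_lt_height {T : CuspTriangle ι} {k : ℕ} (hk : k < τ.height θ T) :
    ¬ τ.IsHinge θ ((τ.acrossBase θ)^[k] T).1 :=
  Nat.notMem_of_lt_sInf (s := {k | τ.IsHinge θ ((τ.acrossBase θ)^[k] T).1}) hk

theorem height_eq {T : CuspTriangle ι} {n : ℕ} (hn : τ.IsHinge θ ((τ.acrossBase θ)^[n] T).1)
    (h : ∀ k < n, ¬ τ.IsHinge θ ((τ.acrossBase θ)^[k] T).1) : τ.height θ T = n := by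
  refine le_antisymm (Nat.sInf_le hn) (not_lt.1 fun hlt => h _ hlt ?_)
  exact Nat.sInf_mem (s := {k | τ.IsHinge θ ((τ.acrossBase θ)^[k] T).1}) ⟨n, hn⟩

variable [Fintype ι]

theorem IsVeering.rotate_iterate_thinCorner (h : τ.IsVeering θ) {b : Bool} (T : CuspTriangle ι)
    {n : ℕ} (hn : ∀ k, 0 < k → k ≤ n → τ.wideColour θ ((τ.acrossBase θ)^[k] T) ≠ b) :
    (τ.rotate b)^[n] (thinCorner θ b T) = thinCorner θ b ((τ.acrossBase θ)^[n] T) := by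
  induction n with
  | zero => rfl
  | succ n ih =>
    have h1 := hn (n + 1) n.succ_pos le_rfl
    rw [Function.iterate_succ_apply'] at h1
    rw [Function.iterate_succ_apply', ih fun k h0 hk => hn k h0 (hk.trans n.le_succ),
      h.rotate_thinCorner, if_neg h1, Function.iterate_succ_apply' (τ.acrossBase θ)]

theorem IsVeering.rotate_iterate_succ_thinCorner (h : τ.IsVeering θ) {b : Bool}
    (T : CuspTriangle ι) {n : ℕ}
    (hn : ∀ k, 0 < k → k < n + 1 → τ.wideColour θ ((τ.acrossBase θ)^[k] T) ≠ b)
    (hb : τ.wideColour θ ((τ.acrossBase θ)^[n + 1] T) = b) :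
    (τ.rotate b)^[n + 1] (thinCorner θ b T) = wideCorner θ ((τ.acrossBase θ)^[n + 1] T) := by
  rw [Function.iterate_succ_apply', h.rotate_iterate_thinCorner T fun k h0 hk =>
    hn k h0 (Nat.lt_succ_of_le hk), h.rotate_thinCorner]
  rw [Function.iterate_succ_apply' (τ.acrossBase θ)] at hb ⊢
  rw [if_pos hb]

theorem IsTaut.not_wide_thinCorner (h : τ.IsTaut θ) (b : Bool) (T : CuspTriangle ι) :
    ¬ Wide θ (thinCorner θ b T) :=
  (h.thin_iff_not_wide _).1 (h.thin_thinCorner b T)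

theorem fanLength_le_dMax {c : Corner ι} (hc : Wide θ c) : τ.fanLength θ c ≤ τ.dMax θ := by
  classical
  unfold dMax
  exact Finset.le_sup (f := τ.fanLength θ) (by simpa using hc)

/-- The length of the fan of a vertex in a ladder, in terms of the colours of the wide corners. -/
theorem IsVeering.fan_le_dMax (h : τ.IsVeering θ) (T : CuspTriangle ι) {m : ℕ}
    (hm : ∀ k, 0 < k → k < m →
      τ.wideColour θ ((τ.acrossBase θ)^[k] T) ≠ τ.wideColour θ T)
    (hb : τ.wideColour θ ((τ.acrossBase θ)^[m] T) = τ.wideColour θ T) : m ≤ τ.dMax θ := by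
  rcases m with _ | n
  · exact Nat.zero_le _
  set b := τ.wideColour θ T with hbdef
  -- The fan in question starts after the wide corner of `acrossPole θ T`, has its m thin corners in
  -- the triangles from `T` on, and ends at the wide corner of the m-th triangle after `T`.
  have h0 : τ.rotate b (wideCorner θ (τ.acrossPole θ T)) = thinCorner θ b T := by
    have := h.rotate_wideCorner (τ.acrossPole θ T)
    rwa [h.wideColour_acrossPole, h.acrossPole_acrossPole] at this
  have h1 : ∀ k < n + 1, (τ.rotate b)^[k + 1] (wideCorner θ (τ.acrossPole θ T)) =
      thinCorner θ b ((τ.acrossBase θ)^[k] T) := by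
    intro k hk
    rw [Function.iterate_succ_apply, h0]
    exact h.rotate_iterate_thinCorner T fun l h0 hl => hm l h0 (hl.trans_lt hk)
  have h2 : (τ.rotate b)^[n + 1 + 1] (wideCorner θ (τ.acrossPole θ T)) =
      wideCorner θ ((τ.acrossBase θ)^[n + 1] T) := by
    rw [Function.iterate_succ_apply, h0]
    exact h.rotate_iterate_succ_thinCorner T hm hb
  generalize hV : τ.acrossPole θ T = V at *
  -- `fanLength` counts clockwise, whereas `rotate false` is counterclockwise: for a red vertex the
  -- fan is counted from its last wide corner backwards.
  cases hbb : b
  · rw [hbb] at h1 h2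
    refine le_trans ?_ (fanLength_le_dMax (h.1.wide_wideCorner ((τ.acrossBase θ)^[n + 1] T)))
    refine le_fanLength (n := n + 1) ?_ fun k hk => ?_
    · rw [← h2]
      have := cw_iterate_rotate_false (τ := τ) (n + 1 + 1) 0 (wideCorner θ V)
      rw [Nat.add_zero] at this
      rw [this]
      exact h.1.wide_wideCorner V
    · rw [← h2]
      have := cw_iterate_rotate_false (τ := τ) (k + 1) (n - k + 1) (wideCorner θ V)
      rw [show k + 1 + (n - k + 1) = n + 1 + 1 by omega] at this
      rw [this, h1 _ (by omega)]
      exact h.1.not_wide_thinCorner _ _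
  · rw [hbb] at h1 h2
    refine le_trans ?_ (fanLength_le_dMax (h.1.wide_wideCorner V))
    refine le_fanLength (n := n + 1) ?_ fun k hk => ?_
    · have : τ.cw^[n + 1 + 1] (wideCorner θ V) = _ := h2
      rw [this]
      exact h.1.wide_wideCorner _
    · have : τ.cw^[k + 1] (wideCorner θ V) = _ := h1 k hk
      rw [this]
      exact h.1.not_wide_thinCorner _ _

theorem IsVeering.exists_iterate_acrossBase_eq_self (h : τ.IsVeering θ) (T : CuspTriangle ι) :
    ∃ n, 0 < n ∧ (τ.acrossBase θ)^[n] T = T :=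
  Function.mem_periodicPts.1 (h.acrossBase_injective.mem_periodicPts T)

/-- Going around the ladder one meets a triangle with the same colour. -/
theorem IsVeering.exists_first_return (h : τ.IsVeering θ) (T : CuspTriangle ι) :
    ∃ n, 0 < n ∧ τ.wideColour θ ((τ.acrossBase θ)^[n] T) = τ.wideColour θ T ∧
      ∀ k, 0 < k → k < n → τ.wideColour θ ((τ.acrossBase θ)^[k] T) ≠ τ.wideColour θ T := by
  classical
  have hex : ∃ n, 0 < n ∧ τ.wideColour θ ((τ.acrossBase θ)^[n] T) = τ.wideColour θ T := by
    obtain ⟨n, hn, hT⟩ := h.exists_iterate_acrossBase_eq_self T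
    exact ⟨n, hn, by rw [hT]⟩
  refine ⟨Nat.find hex, (Nat.find_spec hex).1, (Nat.find_spec hex).2, fun k h0 hk hc => ?_⟩
  exact Nat.find_min hex hk ⟨h0, hc⟩

theorem IsVeering.dMax_pos [Nonempty ι] (h : τ.IsVeering θ) : 0 < τ.dMax θ := by
  obtain ⟨n, hn, hT, hk⟩ := h.exists_first_return (Classical.arbitrary ι, 0)
  exact hn.trans_le (h.fan_le_dMax _ hk hT)

/-- Besides the fan, the vertex has two wide corners and at least one triangle of the other fan,
since wide corners are never adjacent. -/
theorem IsVeering.fanLength_add_three_le (h : τ.IsVeering θ) (T : CuspTriangle ι) :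
    τ.fanLength θ (wideCorner θ T) + 3 ≤ τ.degree (wideCorner θ T) := by
  classical
  set c := wideCorner θ T with hc
  have hw : Wide θ c := h.1.wide_wideCorner T
  set n := τ.degree c with hn
  have hper : τ.cw^[n] c = c := iterate_degree c
  have hpos : 0 < n := Finset.card_pos.2 ⟨c, mem_cornersAt.2 (SameVertex.refl c)⟩
  have hmem : n - 1 ∈ {k | Wide θ (τ.cw^[k + 1] c)} := by
    change Wide θ (τ.cw^[n - 1 + 1] c)
    rw [Nat.sub_add_cancel hpos, hper]
    exact hw
  have hle : τ.fanLength θ c ≤ n - 1 := Nat.sInf_le hmem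
  have hwide : Wide θ (τ.cw^[τ.fanLength θ c + 1] c) :=
    Nat.sInf_mem (s := {k | Wide θ (τ.cw^[k + 1] c)}) ⟨_, hmem⟩
  have hthin : ∀ k < τ.fanLength θ c, ¬ Wide θ (τ.cw^[k + 1] c) := fun k hk =>
    Nat.notMem_of_lt_sInf hk
  have h1 : τ.fanLength θ c + 1 ≠ n := by
    intro heq
    have hsub : (τ.cornersAt c).filter (Wide θ) ⊆ {c} := by
      intro c' hc'
      rw [Finset.mem_filter, cornersAt_eq_image, Finset.mem_image] at hc'
      obtain ⟨⟨k, hk, rfl⟩, hwk⟩ := hc'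
      rw [Finset.mem_range, ← degree_eq, ← hn] at hk
      rcases k with _ | k
      · simp
      · exact absurd hwk (hthin k (by omega))
    have := Finset.card_le_card hsub
    rw [h.1.card_wide c] at this
    simp at this
  have h2 : τ.fanLength θ c + 2 ≠ n := by
    intro heq
    have h3 := h.thin_cw (triangle (τ.cw^[τ.fanLength θ c + 1] c))
    rw [← (h.1.wide_iff_eq_wideCorner _).1 hwide, ← Function.iterate_succ_apply' τ.cw,
      h.1.thin_iff_not_wide] at h3
    have h4 : τ.fanLength θ c + 1 + 1 = n := heq
    rw [Nat.succ_eq_add_one, h4, hper] at h3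
    exact h3 hw
  omega

theorem IsVeering.dMax_add_three_le [Nonempty ι] (h : τ.IsVeering θ) :
    τ.dMax θ + 3 ≤ τ.eMax := by
  classical
  have h1 : τ.dMax θ ≤ τ.eMax - 3 := by
    unfold dMax
    refine Finset.sup_le fun c hc => ?_
    rw [Finset.mem_filter, h.1.wide_iff_eq_wideCorner] at hc
    have h2 := h.fanLength_add_three_le (triangle c)
    rw [← hc.2] at h2
    have h3 : τ.degree c ≤ τ.eMax := Finset.le_sup (f := τ.degree) (Finset.mem_univ c)
    omega
  -- Positivity undoes the truncated subtraction in `h1`.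
  have := h.dMax_pos
  omega

/-! ### Heights -/

/-- Without hinges the wide colour would be constant along the ladder, and the rotation about a
vertex of the other colour would meet thin corners only. -/
theorem IsVeering.exists_isHinge (h : τ.IsVeering θ) (T : CuspTriangle ι) :
    ∃ k, τ.IsHinge θ ((τ.acrossBase θ)^[k] T).1 := by
  by_contra hno
  push Not at hno
  have h1 : ∀ k, τ.wideColour θ ((τ.acrossBase θ)^[k] T) = τ.wideColour θ T := by
    intro k
    induction k with
    | zero => rfl
    | succ k ih =>
      have := hno k
      rw [h.isHinge_iff, not_not, ih] at this
      rwa [Function.iterate_succ_apply']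
  obtain ⟨c, hc, hw⟩ := h.1.exists_wide (thinCorner θ (!τ.wideColour θ T) T)
  obtain ⟨k, rfl⟩ := hc.exists_rotate_pow (!τ.wideColour θ T)
  rw [h.rotate_iterate_thinCorner T fun l _ _ => by rw [h1]; simp] at hw
  exact h.1.not_wide_thinCorner _ _ hw

theorem IsVeering.isHinge_hingeBelow (h : τ.IsVeering θ) (T : CuspTriangle ι) :
    τ.IsHinge θ (τ.hingeBelow θ T).1 :=
  Nat.sInf_mem (s := {k | τ.IsHinge θ ((τ.acrossBase θ)^[k] T).1}) (h.exists_isHinge T)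

theorem IsVeering.height_pos (h : τ.IsVeering θ) {T : CuspTriangle ι} (hT : ¬ τ.IsHinge θ T.1) :
    0 < τ.height θ T := by
  rw [Nat.pos_iff_ne_zero]
  intro h0
  have := h.isHinge_hingeBelow T
  rw [hingeBelow, h0] at this
  exact hT this

theorem IsVeering.height_iterate (h : τ.IsVeering θ) {T : CuspTriangle ι} {k : ℕ}
    (hk : k ≤ τ.height θ T) : τ.height θ ((τ.acrossBase θ)^[k] T) + k = τ.height θ T := by
  have : τ.height θ ((τ.acrossBase θ)^[k] T) = τ.height θ T - k := by
    refine height_eq ?_ fun l hl => ?_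
    · rw [← Function.iterate_add_apply, Nat.sub_add_cancel hk]
      exact h.isHinge_hingeBelow T
    · rw [← Function.iterate_add_apply]
      exact not_isHinge_of_lt_height (by omega)
  omega

theorem IsVeering.height_acrossBase (h : τ.IsVeering θ) {T : CuspTriangle ι}
    (hT : ¬ τ.IsHinge θ T.1) : τ.height θ (τ.acrossBase θ T) + 1 = τ.height θ T :=
  h.height_iterate (k := 1) (h.height_pos hT)

theorem IsVeering.hingeBelow_iterate (h : τ.IsVeering θ) {T : CuspTriangle ι} {k : ℕ}
    (hk : k ≤ τ.height θ T) :
    τ.hingeBelow θ ((τ.acrossBase θ)^[k] T) = τ.hingeBelow θ T := by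
  rw [hingeBelow, hingeBelow, ← Function.iterate_add_apply, h.height_iterate hk]

theorem IsVeering.wideColour_iterate (h : τ.IsVeering θ) {T : CuspTriangle ι} {k : ℕ}
    (hk : ∀ l < k, ¬ τ.IsHinge θ ((τ.acrossBase θ)^[l] T).1) :
    τ.wideColour θ ((τ.acrossBase θ)^[k] T) = τ.wideColour θ T := by
  induction k with
  | zero => rfl
  | succ k ih =>
    have := hk k k.lt_succ_self
    rw [h.isHinge_iff, not_not] at this
    rw [Function.iterate_succ_apply', this, ih fun l hl => hk l (hl.trans k.lt_succ_self)]

theorem IsVeering.wideColour_hingeBelow (h : τ.IsVeering θ) (T : CuspTriangle ι) :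
    τ.wideColour θ (τ.hingeBelow θ T) = τ.wideColour θ T :=
  h.wideColour_iterate fun _ hl => not_isHinge_of_lt_height hl

/-- Let U be the nearest triangle before `T` in the ladder with the other wide colour, n ≥ 1 steps
away; the next one of that colour is `S`, just after the hinge. They bound a fan of length n + H(T)
+ 1. -/
theorem IsVeering.height_add_two_le (h : τ.IsVeering θ) (T : CuspTriangle ι) :
    τ.height θ T + 2 ≤ τ.dMax θ := by
  classical
  have h1 := h.isHinge_hingeBelow T
  rw [h.isHinge_iff, h.wideColour_hingeBelow] at h1
  set S := τ.acrossBase θ (τ.hingeBelow θ T) with hS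
  have hST : (τ.acrossBase θ)^[τ.height θ T + 1] T = S :=
    Function.iterate_succ_apply' _ _ _
  have hex : ∃ n, ∃ U, (τ.acrossBase θ)^[n] U = T ∧ τ.wideColour θ U ≠ τ.wideColour θ T := by
    obtain ⟨n, hn, hT⟩ := h.exists_iterate_acrossBase_eq_self T
    -- The steps from `T` to `S` are completed to a whole number of turns around the ladder, which
    -- leads from `S` back to `T`.
    refine ⟨n * (τ.height θ T + 1) - (τ.height θ T + 1), S, ?_, h1⟩
    rw [← hST, ← Function.iterate_add_apply, Nat.sub_add_cancel (Nat.le_mul_of_pos_left _ hn)]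
    exact Function.IsPeriodicPt.mul_const hT _
  set n := Nat.find hex with hn
  obtain ⟨U, hU, hUT⟩ := Nat.find_spec hex
  have hn0 : n ≠ 0 := by
    intro h0
    rw [← hn, h0] at hU
    exact hUT (congrArg _ hU)
  have hcol : ∀ a b c : Bool, a ≠ b → c ≠ b → a = c := by decide
  have hle := h.fan_le_dMax U (m := τ.height θ T + 1 + n) (fun k hk0 hk => ?_) ?_
  · omega
  · by_cases hkn : k < n
    · intro hc
      refine Nat.find_min hex (m := n - k) (by omega) ⟨(τ.acrossBase θ)^[k] U, ?_, by rwa [hc]⟩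
      rw [← Function.iterate_add_apply, Nat.sub_add_cancel hkn.le, hU]
    · obtain ⟨l, rfl⟩ := Nat.exists_eq_add_of_le' (not_lt.1 hkn)
      rw [Function.iterate_add_apply, hU,
        h.wideColour_iterate fun j hj => not_isHinge_of_lt_height (by omega)]
      exact hUT.symm
  · rw [Function.iterate_add_apply, hU, hST]
    exact hcol _ _ _ h1 hUT

/-- Triangles with the same hinge below them are determined by their heights. -/
theorem IsVeering.card_le_of_hingeBelow_eq (h : τ.IsVeering θ) {A : Finset (CuspTriangle ι)}
    (hA : ∀ T ∈ A, ¬ τ.IsHinge θ T.1)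
    (hA' : ∀ T ∈ A, ∀ T' ∈ A, τ.hingeBelow θ T = τ.hingeBelow θ T') :
    A.card ≤ τ.dMax θ - 2 := by
  have h1 : A.card ≤ (Finset.Icc 1 (τ.dMax θ - 2)).card := by
    refine Finset.card_le_card_of_injOn (τ.height θ) (fun T hT => ?_) fun T hT T' hT' heq => ?_
    · have h2 := h.height_pos (hA T hT)
      have h3 := h.height_add_two_le T
      simp only [Finset.coe_Icc, Set.mem_Icc]
      omega
    · have h2 := hA' T hT T' hT'
      rw [hingeBelow, hingeBelow, heq] at h2
      exact h.acrossBase_injective.iterate _ h2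
  simpa using h1

/-! ### Crossing to the adjacent ladder -/

variable {out : ι → Fin 4 → Bool}

theorem IsTransverseTaut.isAscending_iterate (ht : τ.IsTransverseTaut θ out)
    (h : τ.IsVeering θ) (T : CuspTriangle ι) (k : ℕ) :
    IsAscending θ out ((τ.acrossBase θ)^[k] T) ↔ IsAscending θ out T := by
  induction k with
  | zero => rfl
  | succ k ih => rw [Function.iterate_succ_apply', ht.isAscending_acrossBase h, ih]

/-- The two wide corners at a vertex lie in ladders of opposite directions. -/
theorem IsTransverseTaut.eq_of_sameVertex (ht : τ.IsTransverseTaut θ out) (h : τ.IsVeering θ)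
    {T T' : CuspTriangle ι} (hT : τ.SameVertex (wideCorner θ T) (wideCorner θ T'))
    (ha : IsAscending θ out T ↔ IsAscending θ out T') : T = T' := by
  set b := τ.wideColour θ T with hb
  set S := τ.acrossPole θ T with hS
  have hSb : τ.wideColour θ S = τ.wideColour θ T := h.wideColour_acrossPole T
  -- Rotating from the wide corner of `T` traverses a fan in the adjacent ladder and ends at a wide
  -- corner there. There being only two wide corners, none is left for a second triangle in the
  -- direction of `T`.
  obtain ⟨n, hn, hSn, hk⟩ := h.exists_first_return S
  obtain ⟨m, rfl⟩ := Nat.exists_eq_succ_of_ne_zero hn.ne'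
  have h1 := h.rotate_iterate_succ_thinCorner S hk hSn
  rw [hSb, hS, ← h.rotate_wideCorner] at h1
  have h3 : ∀ b k (c : Corner ι), τ.SameVertex c ((τ.rotate b)^[k] c) := by
    intro b k c
    induction k with
    | zero => exact SameVertex.refl c
    | succ k ih =>
      rw [Function.iterate_succ_apply']
      exact ih.trans (sameVertex_rotate b _)
  have h2 : τ.SameVertex (wideCorner θ T) (wideCorner θ ((τ.acrossBase θ)^[m + 1] S)) := by
    rw [hS, ← h1]
    exact (sameVertex_rotate _ _).trans (h3 _ _ _)
  have h4 : IsAscending θ out ((τ.acrossBase θ)^[m + 1] S) ↔ ¬ IsAscending θ out T := by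
    rw [ht.isAscending_iterate h, ht.isAscending_acrossPole h]
  have hw := h.1.wide_wideCorner
  have h5 : ∀ T', (IsAscending θ out T ↔ IsAscending θ out T') →
      wideCorner θ ((τ.acrossBase θ)^[m + 1] S) ≠ wideCorner θ T' := by
    intro T' ha he
    rw [wideCorner_injective he] at h4
    tauto
  have h6 := h.1.wide_eq h2.symm (h2.symm.trans hT) (hw _) (hw _) (hw _)
    (h5 T Iff.rfl) (h5 T' ha)
  exact wideCorner_injective h6

/-- When `T` is not a hinge, its thin corner on the pole lies at the vertex of the wide corner of
the next triangle. The fan of this vertex beyond the pole leads to its other wide corner, which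
belongs to `acrossPole θ T` by `eq_of_sameVertex`. -/
theorem IsTransverseTaut.exists_path_step (ht : τ.IsTransverseTaut θ out) (h : τ.IsVeering θ)
    {T : CuspTriangle ι} (hT : ¬ τ.IsHinge θ T.1) :
    ∃ n, (τ.acrossBase θ)^[n] (τ.acrossPole θ (τ.acrossBase θ T)) = τ.acrossPole θ T ∧
      ∀ k < n, τ.SameVertex (wideCorner θ (τ.acrossBase θ T))
        (thinCorner θ (τ.wideColour θ T)
          ((τ.acrossBase θ)^[k] (τ.acrossPole θ (τ.acrossBase θ T)))) := by
  rw [h.isHinge_iff, not_not] at hT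
  set S := τ.acrossPole θ (τ.acrossBase θ T) with hS
  have hSb : τ.wideColour θ S = τ.wideColour θ T := (h.wideColour_acrossPole _).trans hT
  obtain ⟨n, hn, hSn, hk⟩ := h.exists_first_return S
  rw [hSb] at hSn hk
  obtain ⟨m, rfl⟩ := Nat.exists_eq_succ_of_ne_zero hn.ne'
  have h3 : ∀ k (c : Corner ι), τ.SameVertex c ((τ.rotate (τ.wideColour θ T))^[k] c) := by
    intro k c
    induction k with
    | zero => exact SameVertex.refl c
    | succ k ih =>
      rw [Function.iterate_succ_apply']
      exact ih.trans (sameVertex_rotate _ _)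
  have h0 : τ.SameVertex (wideCorner θ (τ.acrossBase θ T)) (thinCorner θ (τ.wideColour θ T) S) := by
    have := sameVertex_rotate (τ := τ) (τ.wideColour θ (τ.acrossBase θ T))
      (wideCorner θ (τ.acrossBase θ T))
    rwa [h.rotate_wideCorner, hT] at this
  refine ⟨m + 1, ?_, fun k hkm => ?_⟩
  · have h1 := h.rotate_iterate_succ_thinCorner S hk hSn
    have h2 : τ.SameVertex (wideCorner θ (τ.acrossPole θ T))
        (wideCorner θ ((τ.acrossBase θ)^[m + 1] S)) := by
      refine SameVertex.trans ?_ (h0.trans (h1 ▸ h3 (m + 1) _))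
      have e1 := sameVertex_rotate (τ := τ) (τ.wideColour θ (τ.acrossPole θ T))
        (wideCorner θ (τ.acrossPole θ T))
      rw [h.rotate_wideCorner, h.acrossPole_acrossPole, h.wideColour_acrossPole] at e1
      have e2 := sameVertex_rotate (τ := τ) (τ.wideColour θ T)
        (thinCorner θ (τ.wideColour θ T) T)
      rw [h.rotate_thinCorner, if_pos hT] at e2
      exact e1.trans e2
    refine (ht.eq_of_sameVertex h h2 ?_).symm
    rw [ht.isAscending_iterate h, hS, ht.isAscending_acrossPole h, ht.isAscending_acrossPole h,
      ht.isAscending_acrossBase h]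
  · rw [← h.rotate_iterate_thinCorner S fun l hl hlk => hk l hl (by omega)]
    exact h0.trans (h3 k _)

/-- If the triangles passed on the way down the ladder from `T` are not hinges, then the path down
the ladder is followed by a path up the ladder on the other side of the ladderpole, through
triangles at the vertices passed on the way down. -/
theorem IsTransverseTaut.exists_path (ht : τ.IsTransverseTaut θ out) (h : τ.IsVeering θ)
    (j : ℕ) (T : CuspTriangle ι) (hj : ∀ l < j, ¬ τ.IsHinge θ ((τ.acrossBase θ)^[l] T).1) :
    ∃ n, (τ.acrossBase θ)^[n] (τ.acrossPole θ ((τ.acrossBase θ)^[j] T)) = τ.acrossPole θ T ∧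
      ∀ k < n, ∃ l < j, τ.SameVertex (wideCorner θ ((τ.acrossBase θ)^[l + 1] T))
        (thinCorner θ (τ.wideColour θ T)
          ((τ.acrossBase θ)^[k] (τ.acrossPole θ ((τ.acrossBase θ)^[j] T)))) := by
  induction j generalizing T with
  | zero => exact ⟨0, rfl, fun k hk => absurd hk k.not_lt_zero⟩
  | succ j ih =>
    have hT : ¬ τ.IsHinge θ T.1 := hj 0 j.succ_pos
    obtain ⟨n, hn, hnk⟩ := ih (τ.acrossBase θ T) fun l hl => hj (l + 1) (Nat.succ_lt_succ hl)
    obtain ⟨m, hm, hmk⟩ := ht.exists_path_step h hT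
    rw [h.isHinge_iff, not_not] at hT
    rw [← Function.iterate_succ_apply] at hn hnk
    refine ⟨m + n, by rw [Function.iterate_add_apply, hn, hm], fun k hk => ?_⟩
    by_cases hkn : k < n
    · obtain ⟨l, hl, hs⟩ := hnk k hkn
      rw [hT] at hs
      exact ⟨l + 1, Nat.succ_lt_succ hl, hs⟩
    · obtain ⟨k', rfl⟩ := Nat.exists_eq_add_of_le' (not_lt.1 hkn)
      refine ⟨0, j.succ_pos, ?_⟩
      rw [Function.iterate_add_apply (τ.acrossBase θ) k' n, hn]
      exact hmk k' (by omega)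

end IdealTriangulation

/-! ### The values of the hinge deformation. -/

namespace IdealTriangulation

variable {ι : Type*} {τ : IdealTriangulation ι} {θ : AngleVector ι}

theorem cross_ccwBefore (c : Corner ι) : τ.cross (ccwBefore c) = ccwAfter (τ.cw c) := by
  simp [cw_eq]

variable [Fintype ι]

theorem deformation_vertexLoop (x : Corner ι) (i : ι) (p : Fin 3) :
    τ.deformation (τ.vertexLoop x) i p =
      ∑ c ∈ τ.cornersAt x, (basisVec (ccwAfter c) i p - basisVec (ccwBefore c) i p) := by
  rw [sum_cornersAt, deformation_apply, vertexLoop, List.map_map]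
  have h1 : ∀ (n : ℕ) (f : ℕ → ℝ), ((List.range n).map f).sum = ∑ k ∈ Finset.range n, f k := by
    intro n f
    induction n with
    | zero => simp
    | succ n ih => rw [List.range_succ, Finset.sum_range_succ]; simp [ih]
  rw [h1]
  simp only [Function.comp_apply, cross_ccwBefore, Finset.sum_sub_distrib]
  congr 1
  -- The angles entered are those of the corners one step further around the vertex; the shift is
  -- harmless because the loop closes.
  have h2 := Finset.sum_range_succ (fun k => basisVec (ccwAfter (τ.cw^[k] x)) i p) (τ.degree x)
  rw [Finset.sum_range_succ', iterate_degree, Function.iterate_zero_apply] at h2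
  have h3 := add_right_cancel h2
  simpa only [Function.iterate_succ_apply' τ.cw] using h3

theorem edgeSetoid_iff (a b : Corner ι) :
    τ.edgeSetoid a b ↔ τ.SameVertex a b ∨ τ.SameVertex (rev a) b := by
  constructor
  · intro hab
    change Relation.EqvGen _ a b at hab
    induction hab with
    | rel x y hxy =>
      rcases hxy with rfl | rfl
      · exact Or.inl (sameVertex_cw x)
      · exact Or.inr (SameVertex.refl _)
    | refl x => exact Or.inl (SameVertex.refl x)
    | symm x y _ ih =>
      rcases ih with ih | ih
      · exact Or.inl ih.symm
      · have := sameVertex_rev ih.symm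
        rw [rev_rev] at this
        exact Or.inr this
    | trans x y z _ _ ih1 ih2 =>
      rcases ih1 with h1 | h1 <;> rcases ih2 with h2 | h2
      · exact Or.inl (h1.trans h2)
      · exact Or.inr ((sameVertex_rev h1).trans h2)
      · exact Or.inr (h1.trans h2)
      · have := sameVertex_rev h1
        rw [rev_rev] at this
        exact Or.inl (this.trans h2)
  · have key : ∀ a b, τ.SameVertex a b → τ.edgeSetoid a b := by
      rintro a b ⟨k, rfl⟩
      induction k with
      | zero => exact τ.edgeSetoid.refl a
      | succ k ih =>
        refine τ.edgeSetoid.trans ih (Relation.EqvGen.rel _ _ (Or.inl ?_))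
        rw [Function.iterate_succ_apply']
    rintro (hab | hab)
    · exact key a b hab
    · exact τ.edgeSetoid.trans (Relation.EqvGen.rel _ _ (Or.inr rfl)) (key _ _ hab)

/-- A sum over interior edges of sums over the corners at one end. -/
theorem two_mul_sum_interiorEdge (F : Corner ι → ℝ) (hF : ∀ c, F (rev c) = F c) :
    2 * ∑ ε : τ.InteriorEdge, ∑ c ∈ τ.cornersAt ε.corner, F c = ∑ c, F c := by
  classical
  let q : Corner ι → τ.InteriorEdge := Quotient.mk τ.edgeSetoid
  rw [← Finset.sum_fiberwise (Finset.univ : Finset (Corner ι)) q F, Finset.mul_sum]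
  refine Finset.sum_congr rfl fun ε _ => ?_
  have h1 : (Finset.univ.filter fun c => q c = ε) = τ.cornersAt ε.corner ∪ τ.cornersAt (rev ε.corner) := by
    ext c
    have h2 : q c = ε ↔ τ.edgeSetoid ε.corner c := by
      have h3 : q ε.corner = ε := Quotient.out_eq (s := τ.edgeSetoid) ε
      rw [← Quotient.eq (r := τ.edgeSetoid)]
      change _ ↔ q ε.corner = q c
      rw [h3]
      exact eq_comm
    rw [Finset.mem_filter, h2, edgeSetoid_iff]
    simp
  -- The two ends of the edge are distinct vertices, so the factor 2 is exact.
  have h2 : Disjoint (τ.cornersAt ε.corner) (τ.cornersAt (rev ε.corner)) := by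
    rw [Finset.disjoint_left]
    intro c h1 h2
    rw [mem_cornersAt] at h1 h2
    exact not_sameVertex_rev _ (h1.trans h2.symm)
  have h3 : ∑ c ∈ τ.cornersAt (rev ε.corner), F c = ∑ c ∈ τ.cornersAt ε.corner, F c := by
    refine Finset.sum_bij' (fun c _ => rev c) (fun c _ => rev c) ?_ ?_ ?_ ?_ ?_
    · intro c hc
      rw [mem_cornersAt] at hc ⊢
      simpa using sameVertex_rev hc
    · intro c hc
      rw [mem_cornersAt] at hc ⊢
      exact sameVertex_rev hc
    · intro c _; simp
    · intro c _; simp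
    · intro c _; exact (hF c).symm
  rw [h1, Finset.sum_union h2, h3, two_mul]

/-- The sign `1` for blue and `-1` for red. -/
def sign (b : Bool) : ℝ := if b then 1 else -1

theorem IsVeering.hingeDeformation_apply (h : τ.IsVeering θ) (i : ι) (p : Fin 3) :
    τ.hingeDeformation θ i p = ∑ ε : τ.InteriorEdge, ∑ c ∈ τ.cornersAt ε.corner,
      sign (τ.colour θ c) * (basisVec (ccwAfter c) i p - basisVec (ccwBefore c) i p) := by
  classical
  unfold hingeDeformation
  simp only [h.red_iff, Pi.sub_apply, Finset.sum_apply, Finset.sum_filter]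
  rw [← Finset.sum_sub_distrib]
  refine Finset.sum_congr rfl fun ε _ => ?_
  have h1 : ∑ c ∈ τ.cornersAt ε.corner,
      sign (τ.colour θ c) * (basisVec (ccwAfter c) i p - basisVec (ccwBefore c) i p) =
      sign (τ.colour θ ε.corner) * τ.edgeDeformation ε i p := by
    rw [edgeDeformation, deformation_vertexLoop, Finset.mul_sum]
    refine Finset.sum_congr rfl fun c hc => ?_
    rw [colour_congr (mem_cornersAt.1 hc)]
  rw [h1]
  by_cases hb : τ.Blue θ ε.corner <;> simp [hb, sign, colour]

/-- A clockwise loop raises the angle after each corner that it passes and lowers the angle before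
it. In each cusp triangle the angle `p` is thus raised by the corner `p + 2` and lowered by `p + 1`.
The factor 2 accounts for the two ends of an edge. -/
theorem IsVeering.two_mul_hingeDeformation (h : τ.IsVeering θ) (i : ι) (p : Fin 3) :
    2 * τ.hingeDeformation θ i p =
      ∑ v, (sign (τ.colour θ (i, v, p + 2)) - sign (τ.colour θ (i, v, p + 1))) := by
  classical
  rw [h.hingeDeformation_apply, two_mul_sum_interiorEdge]
  · rw [Fintype.sum_prod_type, Finset.sum_eq_single i]
    · rw [Fintype.sum_prod_type]
      refine Finset.sum_congr rfl fun v _ => ?_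
      simp only [basisVec_apply, ccwAfter, ccwBefore, true_and]
      fin_cases p <;> simp [Fin.sum_univ_three] <;> ring
    · intro j _ hj
      refine Finset.sum_eq_zero fun x _ => ?_
      simp [basisVec_apply, ccwAfter, ccwBefore, hj.symm]
    · simp
  · intro c
    rw [colour_rev]
    simp only [basisVec_apply]
    rfl

theorem IsVeering.sign_thinCorner (h : τ.IsVeering θ) (i : ι) (v : Fin 4) :
    sign (τ.colour θ (i, v, widePair θ i + 1)) = 1 ∧
      sign (τ.colour θ (i, v, widePair θ i + 2)) = -1 := by
  have h1 := h.colour_thinCorner true (i, v)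
  have h2 := h.colour_thinCorner false (i, v)
  simp only [thinCorner, if_true, Bool.false_eq_true, if_false] at h1 h2
  rw [h1, h2]
  simp [sign]

/-- With the coefficient π/6 the wide angle becomes π - 4π/6 = π/3. -/
theorem IsVeering.hingeDeformation_widePair (h : τ.IsVeering θ) (i : ι) :
    τ.hingeDeformation θ i (widePair θ i) = -4 := by
  have h1 := h.two_mul_hingeDeformation i (widePair θ i)
  simp only [(h.sign_thinCorner i _).1, (h.sign_thinCorner i _).2] at h1
  norm_num at h1
  linarith

theorem IsVeering.hingeDeformation_thin (h : τ.IsVeering θ) (i : ι) (b : Bool) :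
    2 * τ.hingeDeformation θ i (widePair θ i + if b then 1 else 2) =
      4 + sign b * ∑ v, sign (τ.wideColour θ (i, v)) := by
  rw [h.two_mul_hingeDeformation]
  cases b
  · simp only [Bool.false_eq_true, if_false, add_two_add_two, add_two_add_one,
      (h.sign_thinCorner i _).1]
    change ∑ v, (1 - sign (τ.wideColour θ (i, v))) = _
    simp [sign]
    ring
  · simp only [if_true, add_one_add_one, add_one_add_two, (h.sign_thinCorner i _).2]
    change ∑ v, (sign (τ.wideColour θ (i, v)) - -1) = _
    simp [sign, Finset.sum_add_distrib]
    ring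

theorem IsVeering.hingeDeformation_of_isHinge (h : τ.IsVeering θ) {i : ι} (hi : τ.IsHinge θ i)
    (b : Bool) : τ.hingeDeformation θ i (widePair θ i + if b then 1 else 2) = 2 := by
  have h1 := h.hingeDeformation_thin i b
  have h2 := (h.isHinge_iff (i, 0)).1 hi
  rw [h.wideColour_acrossBase] at h2
  rw [sum_univ_mate _ 0 (widePair θ i), wideColour_mate, wideColour_mate_add_two] at h1
  have h3 : sign (τ.wideColour θ (i, 0)) +
      sign (τ.wideColour θ (i, mate (widePair θ i + 1) 0)) = 0 := by
    cases h4 : τ.wideColour θ (i, 0) <;>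
      cases h5 : τ.wideColour θ (i, mate (widePair θ i + 1) 0) <;> simp_all [sign]
  linear_combination h1 / 2 + sign b * h3

/-- With the coefficient π/6 the thin angles become 2π/3 and 0. The zero, opposite the ladderpole
sides, is what the rescue curves are for. -/
theorem IsVeering.hingeDeformation_of_not_isHinge (h : τ.IsVeering θ) {i : ι}
    (hi : ¬ τ.IsHinge θ i) (v : Fin 4) :
    τ.hingeDeformation θ i (widePair θ i + if τ.wideColour θ (i, v) then 1 else 2) = 4 ∧
      τ.hingeDeformation θ i (widePair θ i + if !τ.wideColour θ (i, v) then 1 else 2) = 0 := by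
  have h1 := h.hingeDeformation_thin i (τ.wideColour θ (i, v))
  have h2 := h.hingeDeformation_thin i (!τ.wideColour θ (i, v))
  simp only [h.wideColour_eq_of_not_isHinge hi _ v] at h1 h2
  cases hb : τ.wideColour θ (i, v) <;> simp [hb, sign] at h1 h2 ⊢ <;>
    constructor <;> linarith

end IdealTriangulation

/-! ### The rescue curves are closed and have no repetitions on either ladder. -/

namespace IdealTriangulation

variable {ι : Type*} {τ : IdealTriangulation ι} {θ : AngleVector ι} {out : ι → Fin 4 → Bool}

/-- The other cusp triangle of the same tetrahedron whose wide corner is on the same edge. -/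
noncomputable def sibling (θ : AngleVector ι) (T : CuspTriangle ι) : CuspTriangle ι :=
  (T.1, mate (widePair θ T.1) T.2)

variable (τ θ) in
/-- The number of steps up the descending ladder in the curve of the triangle `T`. -/
noncomputable def returnLength (T : CuspTriangle ι) : ℕ :=
  sInf {k | (τ.acrossBase θ)^[k] (τ.acrossPole θ (τ.hingeBelow θ T)) = τ.acrossPole θ T}

theorem rescueCurve_of_isHinge {T : CuspTriangle ι} (hT : τ.IsHinge θ T.1) :
    τ.rescueCurve θ T = [] := by
  simp [rescueCurve, hT]

variable [Fintype ι]

theorem IsTransverseTaut.eq_sibling (ht : τ.IsTransverseTaut θ out) (h : τ.IsTaut θ)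
    {T T' : CuspTriangle ι} (hT : IsAscending θ out T) (hT' : IsAscending θ out T')
    (h1 : T'.1 = T.1) (hne : T' ≠ T) : T' = sibling θ T := by
  obtain ⟨i, v⟩ := T
  obtain ⟨j, u⟩ := T'
  obtain rfl : j = i := h1
  rcases eq_or_eq_mate (widePair θ j) v u with rfl | rfl | rfl | rfl
  · exact absurd rfl hne
  · rfl
  · exact absurd hT ((ht.isAscending_mate_add h j v true).1 hT')
  · exact absurd hT ((ht.isAscending_mate_add h j v false).1 hT')

theorem IsTransverseTaut.isAscending_sibling (ht : τ.IsTransverseTaut θ out) (h : τ.IsTaut θ)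
    (T : CuspTriangle ι) : IsAscending θ out (sibling θ T) ↔ IsAscending θ out T :=
  ht.isAscending_mate h T.1 T.2

theorem mem_ascending {T : CuspTriangle ι} : T ∈ ascending θ out ↔ IsAscending θ out T := by
  simp [ascending]

theorem IsTransverseTaut.rescueDeformation_eq (ht : τ.IsTransverseTaut θ out) (h : τ.IsTaut θ) :
    τ.rescueDeformation θ out = ∑ T ∈ ascending θ out,
      (τ.height θ (sibling θ T) : ℝ) • τ.deformation (τ.rescueCurve θ T) := by
  classical
  unfold rescueDeformation
  refine Finset.sum_congr rfl fun T hT => ?_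
  rw [mem_ascending] at hT
  rw [show ((ascending θ out).filter fun T' => T'.1 = T.1 ∧ T' ≠ T) = {sibling θ T} from ?_,
    Finset.sum_singleton]
  ext T'
  rw [Finset.mem_filter, Finset.mem_singleton, mem_ascending]
  constructor
  · rintro ⟨h1, h2, h3⟩
    exact ht.eq_sibling h hT h1 h2 h3
  · rintro rfl
    refine ⟨(ht.isAscending_sibling h T).2 hT, rfl, fun hc => ?_⟩
    exact mate_ne _ _ (congrArg Prod.snd hc)

theorem IsVeering.rescueCurve_eq (h : τ.IsVeering θ) {T : CuspTriangle ι}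
    (hT : ¬ τ.IsHinge θ T.1) :
    τ.rescueCurve θ T = [τ.poleSide θ (τ.acrossPole θ T)] ++
      (List.range (τ.height θ T)).map (fun k => wideCorner θ ((τ.acrossBase θ)^[k] T)) ++
      [τ.poleSide θ (τ.hingeBelow θ T)] ++
      (List.range (τ.returnLength θ T)).map fun k =>
        wideCorner θ ((τ.acrossBase θ)^[k] (τ.acrossPole θ (τ.hingeBelow θ T))) := by
  rw [← h.cross_poleSide]
  unfold rescueCurve
  rw [if_neg hT]
  rfl

/-- `exists_path` makes the set in `returnLength` nonempty, so the infimum is attained and the curve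
does close up. -/
theorem IsTransverseTaut.acrossBase_iterate_returnLength (ht : τ.IsTransverseTaut θ out)
    (h : τ.IsVeering θ) (T : CuspTriangle ι) :
    (τ.acrossBase θ)^[τ.returnLength θ T] (τ.acrossPole θ (τ.hingeBelow θ T)) =
      τ.acrossPole θ T := by
  obtain ⟨n, hn, -⟩ := ht.exists_path h (τ.height θ T) T fun _ hl => not_isHinge_of_lt_height hl
  exact Nat.sInf_mem (s := {k | (τ.acrossBase θ)^[k] (τ.acrossPole θ (τ.hingeBelow θ T)) =
    τ.acrossPole θ T}) ⟨n, hn⟩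

theorem IsTransverseTaut.exists_sameVertex_of_lt_returnLength (ht : τ.IsTransverseTaut θ out)
    (h : τ.IsVeering θ) {T : CuspTriangle ι} {k : ℕ} (hk : k < τ.returnLength θ T) :
    ∃ l < τ.height θ T, τ.SameVertex (wideCorner θ ((τ.acrossBase θ)^[l + 1] T))
      (thinCorner θ (τ.wideColour θ T)
        ((τ.acrossBase θ)^[k] (τ.acrossPole θ (τ.hingeBelow θ T)))) := by
  obtain ⟨n, hn, hn'⟩ := ht.exists_path h (τ.height θ T) T fun _ hl => not_isHinge_of_lt_height hl
  exact hn' k (hk.trans_le (Nat.sInf_le hn))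

/-- A repeated triangle would give a shortcut, against the minimality of `returnLength`. -/
theorem IsTransverseTaut.injOn_returnLength (ht : τ.IsTransverseTaut θ out) (h : τ.IsVeering θ)
    (T : CuspTriangle ι) : Set.InjOn
      (fun k => (τ.acrossBase θ)^[k] (τ.acrossPole θ (τ.hingeBelow θ T)))
      (Finset.range (τ.returnLength θ T)) := by
  have key : ∀ a b, a < b → b < τ.returnLength θ T →
      (τ.acrossBase θ)^[a] (τ.acrossPole θ (τ.hingeBelow θ T)) ≠
      (τ.acrossBase θ)^[b] (τ.acrossPole θ (τ.hingeBelow θ T)) := by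
    intro a b hab hb heq
    set S := τ.acrossPole θ (τ.hingeBelow θ T) with hS
    have h1 : (τ.acrossBase θ)^[τ.returnLength θ T - b + a] S = τ.acrossPole θ T := by
      rw [Function.iterate_add_apply, heq, ← Function.iterate_add_apply, Nat.sub_add_cancel hb.le]
      exact ht.acrossBase_iterate_returnLength h T
    have h2 : τ.returnLength θ T ≤ τ.returnLength θ T - b + a := Nat.sInf_le h1
    omega
  intro a ha b hb heq
  simp only [Finset.coe_range, Set.mem_Iio] at ha hb
  rcases lt_trichotomy a b with hlt | rfl | hlt
  · exact absurd heq (key a b hlt hb)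
  · rfl
  · exact absurd heq.symm (key b a hlt ha)

theorem IsVeering.injOn_height (h : τ.IsVeering θ) (T : CuspTriangle ι) :
    Set.InjOn (fun k => (τ.acrossBase θ)^[k] T) (Finset.range (τ.height θ T)) := by
  intro a ha b hb heq
  simp only [Finset.coe_range, Set.mem_Iio] at ha hb
  have h1 := h.height_iterate ha.le
  have h2 := h.height_iterate hb.le
  simp only at heq
  rw [heq] at h1
  omega

theorem IsTransverseTaut.isClosedCurve_rescueCurve (ht : τ.IsTransverseTaut θ out)
    (h : τ.IsVeering θ) (T : CuspTriangle ι) : τ.IsClosedCurve (τ.rescueCurve θ T) := by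
  by_cases hT : τ.IsHinge θ T.1
  · rw [rescueCurve_of_isHinge hT]
    exact List.Perm.refl _
  -- On each ladder the triangles entered are the triangles left, shifted by one step.
  have key : ∀ (S : CuspTriangle ι) (n : ℕ),
      [S] ++ (List.range n).map (fun k => τ.acrossBase θ ((τ.acrossBase θ)^[k] S)) =
      (List.range n).map (fun k => (τ.acrossBase θ)^[k] S) ++ [(τ.acrossBase θ)^[n] S] := by
    intro S n
    have e1 : (List.range (n + 1)).map (fun k => (τ.acrossBase θ)^[k] S) =
        [S] ++ (List.range n).map (fun k => τ.acrossBase θ ((τ.acrossBase θ)^[k] S)) := by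
      rw [List.range_succ_eq_map]
      simp only [List.map_cons, List.map_map, Function.iterate_zero_apply, List.singleton_append]
      congr 1
      refine List.map_congr_left fun k _ => ?_
      exact Function.iterate_succ_apply' _ _ _
    rw [← e1, List.range_succ]
    simp
  have hX : ∀ T, triangle (τ.cross (τ.poleSide θ T)) = τ.acrossPole θ T := fun _ => rfl
  have hB : ∀ T, triangle (τ.cross (wideCorner θ T)) = τ.acrossBase θ T := fun _ => rfl
  rw [IsClosedCurve, h.rescueCurve_eq hT]
  simp only [List.map_append, List.map_cons, List.map_nil, List.map_map, Function.comp_def,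
    hX, hB, h.triangle_poleSide, triangle_wideCorner, h.acrossPole_acrossPole]
  rw [key, List.append_assoc, key, ht.acrossBase_iterate_returnLength h]
  change ((_ ++ [τ.hingeBelow θ T]) ++ _).Perm _
  rw [← List.append_assoc]
  refine List.perm_append_comm.trans ?_
  simp only [List.append_assoc]
  exact List.Perm.refl _

variable (τ) in
/-- The tangent space of the space of generalized angle structures. -/
def tangentSpace : Submodule ℝ (AngleVector ι) where
  carrier := {δ | (∀ i, δ i 0 + δ i 1 + δ i 2 = 0) ∧
    ∀ c, ∑ c' ∈ τ.cornersAt c, δ c'.1 c'.2.2 = 0}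
  zero_mem' := by simp
  add_mem' := by
    rintro a b ⟨ha, ha'⟩ ⟨hb, hb'⟩
    refine ⟨fun i => ?_, fun c => ?_⟩
    · simp only [Pi.add_apply]
      linarith [ha i, hb i]
    · simp only [Pi.add_apply, Finset.sum_add_distrib, ha', hb', add_zero]
  smul_mem' := by
    rintro r a ⟨ha, ha'⟩
    refine ⟨fun i => ?_, fun c => ?_⟩
    · simp only [Pi.smul_apply, smul_eq_mul]
      linear_combination r * ha i
    · simp only [Pi.smul_apply, smul_eq_mul, ← Finset.mul_sum, ha', mul_zero]

theorem IsClosedCurve.deformation_mem {γ : List (Side ι)} (hγ : τ.IsClosedCurve γ) :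
    τ.deformation γ ∈ τ.tangentSpace :=
  ⟨hγ.deformation_tetrahedron, hγ.deformation_edge⟩

theorem hingeDeformation_mem : τ.hingeDeformation θ ∈ τ.tangentSpace := by
  classical
  unfold hingeDeformation
  exact Submodule.sub_mem _
    (Submodule.sum_mem _ fun ε _ => (isClosedCurve_vertexLoop _).deformation_mem)
    (Submodule.sum_mem _ fun ε _ => (isClosedCurve_vertexLoop _).deformation_mem)

theorem IsTransverseTaut.rescueDeformation_mem (ht : τ.IsTransverseTaut θ out)
    (h : τ.IsVeering θ) : τ.rescueDeformation θ out ∈ τ.tangentSpace := by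
  rw [ht.rescueDeformation_eq h.1]
  exact Submodule.sum_mem _ fun T _ =>
    Submodule.smul_mem _ _ (ht.isClosedCurve_rescueCurve h T).deformation_mem

theorem IsGeneralizedAngleStructure.add (h : τ.IsGeneralizedAngleStructure θ)
    {δ : AngleVector ι} (hδ : δ ∈ τ.tangentSpace) : τ.IsGeneralizedAngleStructure (θ + δ) where
  tetrahedron i := by
    simp only [Pi.add_apply]
    linarith [h.tetrahedron i, hδ.1 i]
  edge c := by
    simp only [Pi.add_apply, Finset.sum_add_distrib]
    rw [h.edge c, hδ.2 c, add_zero]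

end IdealTriangulation

/-! ### Estimates for the rescue deformation. -/

namespace IdealTriangulation

theorem sum_ite_eq_le_of_injOn {α : Type*} [DecidableEq α] {n : ℕ} {g : ℕ → α}
    (hg : Set.InjOn g (Finset.range n)) (t : α) [Decidable (∃ k < n, g k = t)] :
    ∑ k ∈ Finset.range n, (if g k = t then (1 : ℝ) else 0) ≤
      if ∃ k < n, g k = t then 1 else 0 := by
  rw [Finset.sum_boole]
  split_ifs with h
  · have : ((Finset.range n).filter fun k => g k = t).card ≤ 1 := by
      rw [Finset.card_le_one]
      intro a ha b hb
      rw [Finset.mem_filter] at ha hb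
      exact hg ha.1 hb.1 (ha.2.trans hb.2.symm)
    exact_mod_cast this
  · have : ((Finset.range n).filter fun k => g k = t) = ∅ := by
      ext k
      simp only [Finset.mem_filter, Finset.mem_range, Finset.notMem_empty, iff_false]
      exact fun hk => h ⟨k, hk⟩
    rw [this]
    simp

theorem ite_fst_eq_sum {ι : Type*} [DecidableEq ι] (T : CuspTriangle ι) (i : ι) :
    (if T.1 = i then (1 : ℝ) else 0) = ∑ v, if T = (i, v) then 1 else 0 := by
  obtain ⟨j, u⟩ := T
  by_cases hj : j = i <;> simp [hj]

theorem neg_sum_le_sum_sub {ι : Type*} (f : Side ι → ℝ) (hf : ∀ s, 0 ≤ f s)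
    (φ : Side ι → Side ι) (n : ℕ) (g : ℕ → Side ι) :
    -∑ k ∈ Finset.range n, f (g k) ≤
      (((List.range n).map g).map fun s => f (φ s) - f s).sum := by
  induction n with
  | zero => simp
  | succ n ih =>
    rw [List.range_succ, Finset.sum_range_succ]
    simp only [List.map_append, List.sum_append, List.map_cons, List.map_nil, List.sum_cons,
      List.sum_nil]
    linarith [hf (φ (g n))]

variable {ι : Type*} {τ : IdealTriangulation ι} {θ : AngleVector ι} {out : ι → Fin 4 → Bool}

theorem basisVec_wideCorner [DecidableEq ι] (T : CuspTriangle ι) (i : ι) :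
    basisVec (wideCorner θ T) i (widePair θ i) = if T.1 = i then 1 else 0 := by
  rw [basisVec_apply]
  by_cases hi : T.1 = i
  · subst hi; simp [wideCorner]
  · simp [wideCorner, hi, Ne.symm hi]

theorem basisVec_wideCorner_thin (T : CuspTriangle ι) (i : ι) (b : Bool) :
    basisVec (wideCorner θ T) i (widePair θ i + if b then 1 else 2) = 0 := by
  classical
  rw [basisVec_apply, if_neg]
  rintro ⟨rfl, h2⟩
  simp only [wideCorner] at h2
  revert h2
  generalize widePair θ T.1 = w
  revert w b
  decide

variable (τ θ) in
/-- The weight of the curve of a cusp triangle. -/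
noncomputable def weight (T : CuspTriangle ι) : ℝ := τ.height θ (sibling θ T)

theorem weight_nonneg (T : CuspTriangle ι) : 0 ≤ τ.weight θ T := Nat.cast_nonneg _

variable [Fintype ι]

/-! ### Lower bounds for the deformation of a curve -/

/-- All decreases are kept, but of the increases only the one on entering `T` through its ladderpole
side: the others are not needed. -/
theorem IsVeering.le_deformation_rescueCurve (h : τ.IsVeering θ) {T : CuspTriangle ι}
    (hT : ¬ τ.IsHinge θ T.1) (i : ι) (p : Fin 3) :
    basisVec (τ.poleSide θ T) i p - basisVec (τ.poleSide θ (τ.acrossPole θ T)) i p -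
      basisVec (τ.poleSide θ (τ.hingeBelow θ T)) i p -
      ∑ k ∈ Finset.range (τ.height θ T), basisVec (wideCorner θ ((τ.acrossBase θ)^[k] T)) i p -
      ∑ k ∈ Finset.range (τ.returnLength θ T), basisVec (wideCorner θ
        ((τ.acrossBase θ)^[k] (τ.acrossPole θ (τ.hingeBelow θ T)))) i p ≤
    τ.deformation (τ.rescueCurve θ T) i p := by
  have h0 : ∀ s : Side ι, 0 ≤ basisVec s i p := fun s => basisVec_nonneg s i p
  have h1 := neg_sum_le_sum_sub (fun s => basisVec s i p) h0 τ.cross (τ.height θ T)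
    fun k => wideCorner θ ((τ.acrossBase θ)^[k] T)
  have h2 := neg_sum_le_sum_sub (fun s => basisVec s i p) h0 τ.cross (τ.returnLength θ T)
    fun k => wideCorner θ ((τ.acrossBase θ)^[k] (τ.acrossPole θ (τ.hingeBelow θ T)))
  rw [deformation_apply, h.rescueCurve_eq hT]
  simp only [List.map_append, List.sum_append, List.map_cons, List.map_nil, List.sum_cons,
    List.sum_nil] at h1 h2 ⊢
  rw [h.cross_poleSide, h.acrossPole_acrossPole]
  linarith [h0 (τ.cross (τ.poleSide θ (τ.hingeBelow θ T)))]

theorem IsVeering.basisVec_poleSide_wide (h : τ.IsVeering θ) (T : CuspTriangle ι) (i : ι) :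
    basisVec (τ.poleSide θ T) i (widePair θ i) = 0 := by
  classical
  rw [basisVec_apply, if_neg]
  rw [h.poleSide_eq]
  generalize τ.wideColour θ T = b
  rintro ⟨rfl, h2⟩
  simp only [thinCorner] at h2
  revert h2
  generalize widePair θ T.1 = w
  revert w b
  decide

theorem IsVeering.basisVec_poleSide (h : τ.IsVeering θ) [DecidableEq ι] (T : CuspTriangle ι)
    (i : ι) (b : Bool) :
    basisVec (τ.poleSide θ T) i (widePair θ i + if b then 1 else 2) =
      if T.1 = i ∧ τ.wideColour θ T = !b then 1 else 0 := by
  rw [basisVec_apply, h.poleSide_eq]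
  refine if_congr ?_ rfl rfl
  generalize τ.wideColour θ T = b'
  constructor
  · rintro ⟨rfl, h2⟩
    refine ⟨rfl, ?_⟩
    simp only [thinCorner] at h2
    revert h2
    generalize widePair θ T.1 = w
    revert w b b'
    decide
  · rintro ⟨rfl, rfl⟩
    exact ⟨rfl, by simp [thinCorner]⟩

/-! ### Weighted counts of curves -/

variable (τ θ out) in
open Classical in
/-- The cusp triangles in ascending ladders that are not hinges. -/
noncomputable def rescued : Finset (CuspTriangle ι) :=
  (ascending θ out).filter fun T => ¬ τ.IsHinge θ T.1

theorem mem_rescued {T : CuspTriangle ι} :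
    T ∈ τ.rescued θ out ↔ IsAscending θ out T ∧ ¬ τ.IsHinge θ T.1 := by
  classical
  rw [rescued, Finset.mem_filter, mem_ascending]

theorem IsVeering.weight_le (h : τ.IsVeering θ) (T : CuspTriangle ι) :
    τ.weight θ T ≤ (τ.dMax θ : ℝ) - 2 := by
  have := h.height_add_two_le (sibling θ T)
  have h1 : (τ.height θ (sibling θ T) : ℝ) + 2 ≤ τ.dMax θ := by exact_mod_cast this
  rw [weight]
  linarith

theorem IsVeering.sub_two_nonneg (h : τ.IsVeering θ) (T : CuspTriangle ι) :
    0 ≤ (τ.dMax θ : ℝ) - 2 :=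
  (weight_nonneg T).trans (h.weight_le T)

theorem IsTransverseTaut.rescueDeformation_apply (ht : τ.IsTransverseTaut θ out)
    (h : τ.IsTaut θ) (i : ι) (p : Fin 3) :
    τ.rescueDeformation θ out i p =
      ∑ T ∈ τ.rescued θ out, τ.weight θ T * τ.deformation (τ.rescueCurve θ T) i p := by
  classical
  rw [ht.rescueDeformation_eq h, rescued, Finset.sum_filter]
  simp only [Finset.sum_apply, Pi.smul_apply, smul_eq_mul]
  refine Finset.sum_congr rfl fun T _ => ?_
  split_ifs with hT
  · rw [rescueCurve_of_isHinge hT]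
    simp [deformation]
  · rfl

/-- Triangles above the same hinge number at most d - 2, and each has weight at most d - 2. -/
theorem IsVeering.sum_weight_le (h : τ.IsVeering θ) (A : Finset (CuspTriangle ι))
    (hA : ∀ T ∈ A, ¬ τ.IsHinge θ T.1)
    (hA' : ∀ T ∈ A, ∀ T' ∈ A, τ.hingeBelow θ T = τ.hingeBelow θ T') :
    ∑ T ∈ A, τ.weight θ T ≤ ((τ.dMax θ : ℝ) - 2) ^ 2 := by
  rcases A.eq_empty_or_nonempty with rfl | ⟨T, hT⟩
  · simpa using sq_nonneg _
  have h1 := Finset.sum_le_card_nsmul A (τ.weight θ) _ fun T _ => h.weight_le T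
  have h2 : (A.card : ℝ) ≤ (τ.dMax θ : ℝ) - 2 := by
    have h3 := h.card_le_of_hingeBelow_eq hA hA'
    have h4 := h.height_add_two_le T
    have h5 : A.card + 2 ≤ τ.dMax θ := by omega
    have h6 : (A.card : ℝ) + 2 ≤ τ.dMax θ := by exact_mod_cast h5
    linarith
  rw [nsmul_eq_mul] at h1
  have := mul_le_mul_of_nonneg_right h2 (h.sub_two_nonneg T)
  rw [sq]
  linarith

open Classical in
-- All curves that go down through `t` continue to the same hinge.
theorem IsTransverseTaut.sum_weight_down_le (ht : τ.IsTransverseTaut θ out)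
    (h : τ.IsVeering θ) (t : CuspTriangle ι) :
    ∑ T ∈ τ.rescued θ out, τ.weight θ T *
      (if ∃ k < τ.height θ T, (τ.acrossBase θ)^[k] T = t then 1 else 0) ≤
    if IsAscending θ out t then ((τ.dMax θ : ℝ) - 2) ^ 2 else 0 := by
  simp only [mul_ite, mul_one, mul_zero, ← Finset.sum_filter]
  split_ifs with hasc
  · refine h.sum_weight_le _ (fun T hT => ?_) fun T hT T' hT' => ?_
    · exact (mem_rescued.1 (Finset.mem_filter.1 hT).1).2
    · obtain ⟨k, hk, hkt⟩ := (Finset.mem_filter.1 hT).2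
      obtain ⟨k', hk', hkt'⟩ := (Finset.mem_filter.1 hT').2
      rw [← h.hingeBelow_iterate hk.le, ← h.hingeBelow_iterate hk'.le, hkt, hkt']
  · refine (Finset.sum_eq_zero fun T hT => absurd ?_ hasc).le
    obtain ⟨hT', k, -, rfl⟩ := Finset.mem_filter.1 hT
    rw [ht.isAscending_iterate h]
    exact (mem_rescued.1 hT').1

open Classical in
-- A descending ladder has a blue and a red ladderpole, and a return path may come from either. For
-- each colour, `t` has one vertex on the pole and this vertex has only one ascending wide corner,
-- which determines the hinge; hence the factor 2.
theorem IsTransverseTaut.sum_weight_up_le (ht : τ.IsTransverseTaut θ out)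
    (h : τ.IsVeering θ) (t : CuspTriangle ι) :
    ∑ T ∈ τ.rescued θ out, τ.weight θ T *
      (if ∃ k < τ.returnLength θ T,
        (τ.acrossBase θ)^[k] (τ.acrossPole θ (τ.hingeBelow θ T)) = t then 1 else 0) ≤
    if IsAscending θ out t then 0 else 2 * ((τ.dMax θ : ℝ) - 2) ^ 2 := by
  simp only [mul_ite, mul_one, mul_zero, ← Finset.sum_filter]
  split_ifs with hasc
  · refine (Finset.sum_eq_zero fun T hT => absurd hasc ?_).le
    obtain ⟨hT', k, -, rfl⟩ := Finset.mem_filter.1 hT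
    rw [ht.isAscending_iterate h, ht.isAscending_acrossPole h, not_not, hingeBelow,
      ht.isAscending_iterate h]
    exact (mem_rescued.1 hT').1
  · rw [← Finset.sum_filter_add_sum_filter_not _ (fun T => τ.wideColour θ T = true), two_mul]
    have key : ∀ (b : Bool) (A : Finset (CuspTriangle ι)),
        (∀ T ∈ A, T ∈ τ.rescued θ out ∧ (∃ k < τ.returnLength θ T,
          (τ.acrossBase θ)^[k] (τ.acrossPole θ (τ.hingeBelow θ T)) = t) ∧
          τ.wideColour θ T = b) →
        ∑ T ∈ A, τ.weight θ T ≤ ((τ.dMax θ : ℝ) - 2) ^ 2 := by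
      intro b A hA
      refine h.sum_weight_le _ (fun T hT => (mem_rescued.1 (hA T hT).1).2) fun T hT T' hT' => ?_
      have h1 : ∀ T ∈ A, ∃ l, IsAscending θ out ((τ.acrossBase θ)^[l] T) ∧
          τ.hingeBelow θ ((τ.acrossBase θ)^[l] T) = τ.hingeBelow θ T ∧
          τ.SameVertex (wideCorner θ ((τ.acrossBase θ)^[l] T)) (thinCorner θ b t) := by
        intro T hT
        obtain ⟨h2, ⟨k, hk, hkt⟩, h3⟩ := hA T hT
        obtain ⟨l, hl, hs⟩ := ht.exists_sameVertex_of_lt_returnLength h hk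
        rw [hkt, h3] at hs
        exact ⟨l + 1, (ht.isAscending_iterate h _ _).2 (mem_rescued.1 h2).1,
          h.hingeBelow_iterate hl, hs⟩
      obtain ⟨l, ha, hb, hs⟩ := h1 T hT
      obtain ⟨l', ha', hb', hs'⟩ := h1 T' hT'
      rw [← hb, ← hb', ht.eq_of_sameVertex h (hs.trans hs'.symm) (iff_of_true ha ha')]
    refine add_le_add (key true _ fun T hT => ?_) (key false _ fun T hT => ?_)
    · simpa only [Finset.mem_filter, and_assoc] using hT
    · simpa only [Finset.mem_filter, and_assoc, Bool.not_eq_true] using hT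

open Classical in
theorem IsTransverseTaut.sum_weight_hingeBelow_le (ht : τ.IsTransverseTaut θ out)
    (h : τ.IsVeering θ) (t : CuspTriangle ι) :
    ∑ T ∈ τ.rescued θ out, τ.weight θ T * (if τ.hingeBelow θ T = t then 1 else 0) ≤
    if IsAscending θ out t then ((τ.dMax θ : ℝ) - 2) ^ 2 else 0 := by
  simp only [mul_ite, mul_one, mul_zero, ← Finset.sum_filter]
  split_ifs with hasc
  · refine h.sum_weight_le _ (fun T hT => ?_) fun T hT T' hT' => ?_
    · exact (mem_rescued.1 (Finset.mem_filter.1 hT).1).2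
    · rw [(Finset.mem_filter.1 hT).2, (Finset.mem_filter.1 hT').2]
  · refine (Finset.sum_eq_zero fun T hT => absurd ?_ hasc).le
    obtain ⟨hT', rfl⟩ := Finset.mem_filter.1 hT
    rw [hingeBelow, ht.isAscending_iterate h]
    exact (mem_rescued.1 hT').1

open Classical in
theorem IsVeering.sum_weight_acrossPole (h : τ.IsVeering θ) (t : CuspTriangle ι) :
    ∑ T ∈ τ.rescued θ out, τ.weight θ T * (if τ.acrossPole θ T = t then 1 else 0) =
    if τ.acrossPole θ t ∈ τ.rescued θ out then τ.weight θ (τ.acrossPole θ t) else 0 := by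
  have h1 : ∀ T, τ.acrossPole θ T = t ↔ T = τ.acrossPole θ t := fun T =>
    ⟨fun h2 => by rw [← h2, h.acrossPole_acrossPole],
      fun h2 => by rw [h2, h.acrossPole_acrossPole]⟩
  simp only [h1, mul_ite, mul_one, mul_zero, Finset.sum_ite_eq']

/-! ### Lower bounds for the angles -/

/-- Two of the four cusp triangles of a tetrahedron are ascending and two are descending. -/
theorem IsTransverseTaut.sum_ite_isAscending (ht : τ.IsTransverseTaut θ out) (h : τ.IsTaut θ)
    (i : ι) (a b : ℝ) [∀ v, Decidable (IsAscending θ out (i, v))] :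
    ∑ v, (if IsAscending θ out (i, v) then a else b) = 2 * a + 2 * b := by
  rw [sum_univ_mate _ 0 (widePair θ i)]
  have h1 := ht.isAscending_mate h i 0
  have h2 := ht.isAscending_mate_add h i 0 true
  have h3 := ht.isAscending_mate_add h i 0 false
  simp only [if_true, Bool.false_eq_true, if_false] at h2 h3
  simp only [h1, h2, h3]
  by_cases h0 : IsAscending θ out (i, 0) <;> simp [h0] <;> ring

/-- Only crossings of bases lower a wide angle. Each of the two ascending triangles contributes at
most (d - 2)², each of the two descending ones at most 2(d - 2)². -/
theorem IsTransverseTaut.rescueDeformation_wide (ht : τ.IsTransverseTaut θ out)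
    (h : τ.IsVeering θ) (i : ι) :
    -(6 * ((τ.dMax θ : ℝ) - 2) ^ 2) ≤ τ.rescueDeformation θ out i (widePair θ i) := by
  classical
  rw [ht.rescueDeformation_apply h.1]
  have h1 : ∀ T ∈ τ.rescued θ out,
      -∑ v, (τ.weight θ T *
          (if ∃ k < τ.height θ T, (τ.acrossBase θ)^[k] T = (i, v) then 1 else 0) +
        τ.weight θ T * (if ∃ k < τ.returnLength θ T,
          (τ.acrossBase θ)^[k] (τ.acrossPole θ (τ.hingeBelow θ T)) = (i, v) then 1 else 0)) ≤
      τ.weight θ T * τ.deformation (τ.rescueCurve θ T) i (widePair θ i) := by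
    intro T hT
    have h2 := h.le_deformation_rescueCurve (mem_rescued.1 hT).2 i (widePair θ i)
    simp only [h.basisVec_poleSide_wide, basisVec_wideCorner, ite_fst_eq_sum] at h2
    rw [Finset.sum_comm, Finset.sum_comm (s := Finset.range (τ.returnLength θ T))] at h2
    have h3 := Finset.sum_le_sum fun v (_ : v ∈ Finset.univ) =>
      sum_ite_eq_le_of_injOn (h.injOn_height T) (i, v)
    have h4 := Finset.sum_le_sum fun v (_ : v ∈ Finset.univ) =>
      sum_ite_eq_le_of_injOn (ht.injOn_returnLength h T) (i, v)
    rw [Finset.sum_add_distrib, ← Finset.mul_sum, ← Finset.mul_sum, ← mul_add, ← mul_neg]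
    refine mul_le_mul_of_nonneg_left ?_ (weight_nonneg T)
    linarith
  refine le_trans ?_ (Finset.sum_le_sum h1)
  rw [Finset.sum_neg_distrib, neg_le_neg_iff, Finset.sum_comm]
  simp only [Finset.sum_add_distrib (s := τ.rescued θ out)]
  have h5 := Finset.sum_le_sum fun v (_ : v ∈ Finset.univ) =>
    add_le_add (ht.sum_weight_down_le h (i, v)) (ht.sum_weight_up_le h (i, v))
  refine h5.trans ?_
  rw [Finset.sum_add_distrib, ht.sum_ite_isAscending h.1, ht.sum_ite_isAscending h.1]
  linarith

/-- Thin angles are lowered only where a curve leaves through a ladderpole side: at the start, from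
a descending triangle that serves at most one curve, and at the hinge, where all curves above it
meet. -/
theorem IsTransverseTaut.rescueDeformation_of_isHinge (ht : τ.IsTransverseTaut θ out)
    (h : τ.IsVeering θ) (i : ι) (b : Bool) :
    -(2 * ((τ.dMax θ : ℝ) - 2) ^ 2 + 2 * ((τ.dMax θ : ℝ) - 2)) ≤
      τ.rescueDeformation θ out i (widePair θ i + if b then 1 else 2) := by
  classical
  rw [ht.rescueDeformation_apply h.1]
  have h1 : ∀ T ∈ τ.rescued θ out,
      -∑ v, (τ.weight θ T * (if τ.acrossPole θ T = (i, v) then 1 else 0) +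
        τ.weight θ T * (if τ.hingeBelow θ T = (i, v) then 1 else 0)) ≤
      τ.weight θ T * τ.deformation (τ.rescueCurve θ T) i
        (widePair θ i + if b then 1 else 2) := by
    intro T hT
    have h2 := h.le_deformation_rescueCurve (mem_rescued.1 hT).2 i
      (widePair θ i + if b then 1 else 2)
    have h3 : ∀ T, basisVec (τ.poleSide θ T) i (widePair θ i + if b then 1 else 2) ≤
        if T.1 = i then 1 else 0 := by
      intro T
      rw [h.basisVec_poleSide]
      by_cases hi : T.1 = i
      · simp only [hi, true_and, if_true]
        split_ifs <;> norm_num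
      · simp [hi]
    have h4 := h3 (τ.acrossPole θ T)
    have h5 := h3 (τ.hingeBelow θ T)
    have h6 := basisVec_nonneg (τ.poleSide θ T) i (widePair θ i + if b then 1 else 2)
    simp only [basisVec_wideCorner_thin, Finset.sum_const_zero] at h2
    rw [ite_fst_eq_sum] at h4 h5
    rw [Finset.sum_add_distrib, ← Finset.mul_sum, ← Finset.mul_sum, ← mul_add, ← mul_neg]
    refine mul_le_mul_of_nonneg_left ?_ (weight_nonneg T)
    linarith
  refine le_trans ?_ (Finset.sum_le_sum h1)
  rw [Finset.sum_neg_distrib, neg_le_neg_iff, Finset.sum_comm]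
  simp only [Finset.sum_add_distrib (s := τ.rescued θ out)]
  have h2 : ∀ t, ∑ T ∈ τ.rescued θ out, τ.weight θ T *
      (if τ.acrossPole θ T = t then 1 else 0) ≤
      if IsAscending θ out t then 0 else (τ.dMax θ : ℝ) - 2 := by
    intro t
    rw [h.sum_weight_acrossPole]
    by_cases hasc : IsAscending θ out t
    · rw [if_pos hasc, if_neg]
      rw [mem_rescued, ht.isAscending_acrossPole h]
      tauto
    · rw [if_neg hasc]
      split_ifs
      · exact h.weight_le _
      · exact h.sub_two_nonneg t
  have h5 := Finset.sum_le_sum fun v (_ : v ∈ Finset.univ) =>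
    add_le_add (h2 (i, v)) (ht.sum_weight_hingeBelow_le h (i, v))
  refine h5.trans ?_
  rw [Finset.sum_add_distrib, ht.sum_ite_isAscending h.1, ht.sum_ite_isAscending h.1]
  linarith

/-- In a tetrahedron that is not a hinge this angle is opposite the rung that is not the base, in
all four triangles. Curves only leave through bases and ladderpole sides, so it is never lowered. -/
theorem IsTransverseTaut.rescueDeformation_rung (ht : τ.IsTransverseTaut θ out)
    (h : τ.IsVeering θ) {i : ι} (hi : ¬ τ.IsHinge θ i) (v : Fin 4) :
    0 ≤ τ.rescueDeformation θ out i
      (widePair θ i + if τ.wideColour θ (i, v) then 1 else 2) := by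
  classical
  rw [ht.rescueDeformation_apply h.1]
  refine Finset.sum_nonneg fun T hT => mul_nonneg (weight_nonneg T) ?_
  have h2 := h.le_deformation_rescueCurve (mem_rescued.1 hT).2 i
      (widePair θ i + if τ.wideColour θ (i, v) then 1 else 2)
  have h3 : ∀ T, basisVec (τ.poleSide θ T) i
      (widePair θ i + if τ.wideColour θ (i, v) then 1 else 2) = 0 := by
    intro T
    rw [h.basisVec_poleSide, if_neg]
    rintro ⟨rfl, hc⟩
    rw [h.wideColour_eq_of_not_isHinge hi v T.2] at hc
    simp at hc
  simp only [basisVec_wideCorner_thin, Finset.sum_const_zero, h3] at h2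
  linarith

/-- The bases of the ascending triangles of a tetrahedron lie in the faces of the ladderpole sides
of its descending triangles. -/
theorem IsTransverseTaut.acrossBase_eq_sibling (ht : τ.IsTransverseTaut θ out)
    (h : τ.IsVeering θ) (i : ι) (v : Fin 4) (hv : ¬ IsAscending θ out (i, v)) :
    τ.acrossBase θ (i, mate (widePair θ i)
      (mate (widePair θ i + if !τ.wideColour θ (i, v) then 1 else 2) v)) =
    sibling θ (τ.acrossPole θ (i, v)) := by
  set p := widePair θ i + if !τ.wideColour θ (i, v) then 1 else 2 with hp
  set u := mate (widePair θ i) (mate p v) with hu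
  have h1 : τ.acrossPole θ (i, v) =
      (τ.nbr i (mate p v), τ.glue i (mate p v) v) := by
    rw [acrossPole, h.poleSide_eq]
    rfl
  have h2 : τ.acrossBase θ (i, u) = (τ.nbr i (mate p v), τ.glue i (mate p v) u) := by
    have : mate (widePair θ i) u = mate p v := mate_mate _ _
    rw [← this]
    rfl
  -- Both triangles of the neighbour are ascending and lie in one tetrahedron; being different, they
  -- are siblings.
  have hasc : IsAscending θ out (i, u) := by
    rw [ht.isAscending_mate h.1, ht.isAscending_mate_add h.1]
    exact hv
  refine ht.eq_sibling h.1 ((ht.isAscending_acrossPole h _).2 hv)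
    ((ht.isAscending_acrossBase h _).2 hasc) (by rw [h1, h2]) ?_
  rw [h1, h2]
  intro hc
  have h3 := (τ.glue i (mate p v)).injective (congrArg Prod.snd hc)
  rw [h3] at hasc
  exact hv hasc

/-- The ascending triangles T₁, T₂ contribute H(T₂) + H(T₁). Each descending triangle costs at most
the height of the triangle just below one of them, and each of T₁, T₂ is used once: in total at
least H(T₁) + H(T₂) - (H(T₁) - 1) - (H(T₂) - 1) = 2. -/
theorem IsTransverseTaut.rescueDeformation_pole (ht : τ.IsTransverseTaut θ out)
    (h : τ.IsVeering θ) {i : ι} (hi : ¬ τ.IsHinge θ i) (v : Fin 4) :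
    2 ≤ τ.rescueDeformation θ out i
      (widePair θ i + if !τ.wideColour θ (i, v) then 1 else 2) := by
  classical
  wlog hv : IsAscending θ out (i, v) generalizing v
  · have h1 := this (mate (widePair θ i + if true then 1 else 2) v)
      ((ht.isAscending_mate_add h.1 i v true).2 hv)
    rwa [h.wideColour_eq_of_not_isHinge hi _ v] at h1
  set b := τ.wideColour θ (i, v) with hb
  have hcol : ∀ u, τ.wideColour θ (i, u) = b := fun u =>
    h.wideColour_eq_of_not_isHinge hi u v
  rw [ht.rescueDeformation_apply h.1]
  have h1 : ∀ T ∈ τ.rescued θ out,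
      ∑ u, (τ.weight θ T * (if T = (i, u) then 1 else 0) -
        τ.weight θ T * (if τ.acrossPole θ T = (i, u) then 1 else 0)) ≤
      τ.weight θ T * τ.deformation (τ.rescueCurve θ T) i
        (widePair θ i + if !b then 1 else 2) := by
    intro T hT
    have h2 := h.le_deformation_rescueCurve (mem_rescued.1 hT).2 i
      (widePair θ i + if !b then 1 else 2)
    have h3 : ∀ T, basisVec (τ.poleSide θ T) i (widePair θ i + if !b then 1 else 2) =
        if T.1 = i then 1 else 0 := by
      intro T
      rw [h.basisVec_poleSide]
      refine if_congr ⟨fun h4 => h4.1, fun h4 => ⟨h4, ?_⟩⟩ rfl rfl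
      subst h4
      rw [Bool.not_not]
      exact hcol T.2
    have h4 : (τ.hingeBelow θ T).1 ≠ i := fun hc => hi (hc ▸ h.isHinge_hingeBelow T)
    simp only [basisVec_wideCorner_thin, Finset.sum_const_zero, h3, if_neg h4] at h2
    rw [ite_fst_eq_sum, ite_fst_eq_sum] at h2
    rw [Finset.sum_sub_distrib, ← Finset.mul_sum, ← Finset.mul_sum, ← mul_sub]
    refine mul_le_mul_of_nonneg_left ?_ (weight_nonneg T)
    linarith
  refine le_trans ?_ (Finset.sum_le_sum h1)
  rw [Finset.sum_comm]
  simp only [Finset.sum_sub_distrib (s := τ.rescued θ out), h.sum_weight_acrossPole]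
  simp only [mul_ite, mul_one, mul_zero, Finset.sum_ite_eq']
  have hheight : ∀ u, (τ.height θ (τ.acrossBase θ (i, u)) : ℝ) + 1 = τ.height θ (i, u) := by
    intro u
    exact_mod_cast h.height_acrossBase (T := (i, u)) hi
  have hpos : ∀ u, IsAscending θ out (i, u) →
      (if (i, u) ∈ τ.rescued θ out then τ.weight θ (i, u) else 0) -
        (if τ.acrossPole θ (i, u) ∈ τ.rescued θ out then
          τ.weight θ (τ.acrossPole θ (i, u)) else 0) =
      τ.height θ (i, mate (widePair θ i) u) := by
    intro u hu
    rw [if_pos (mem_rescued.2 ⟨hu, hi⟩), if_neg, sub_zero]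
    · rfl
    · rw [mem_rescued, ht.isAscending_acrossPole h]
      tauto
  have hneg : ∀ u, ¬ IsAscending θ out (i, u) →
      1 - (τ.height θ (i, mate (widePair θ i) (mate (widePair θ i + if !b then 1 else 2) u)) : ℝ) ≤
      (if (i, u) ∈ τ.rescued θ out then τ.weight θ (i, u) else 0) -
        (if τ.acrossPole θ (i, u) ∈ τ.rescued θ out then
          τ.weight θ (τ.acrossPole θ (i, u)) else 0) := by
    intro u hu
    have hu' : (i, u) ∉ τ.rescued θ out := fun hc => hu (mem_rescued.1 hc).1
    rw [if_neg hu', ← hheight]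
    have h5 := ht.acrossBase_eq_sibling h i u hu
    rw [hcol] at h5
    rw [h5]
    have h6 : (τ.height θ (sibling θ (τ.acrossPole θ (i, u))) : ℝ) =
      τ.weight θ (τ.acrossPole θ (i, u)) := rfl
    rw [h6]
    have h7 := weight_nonneg (τ := τ) (θ := θ) (τ.acrossPole θ (i, u))
    -- If the triangle across the pole is a hinge, no curve starts there and nothing is lost, which
    -- only helps.
    split_ifs <;> linarith
  have a1 := ht.isAscending_mate h.1 i v
  have a2 := ht.isAscending_mate_add h.1 i v true
  have a3 := ht.isAscending_mate_add h.1 i v false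
  simp only [if_true, Bool.false_eq_true, if_false] at a2 a3
  rw [sum_univ_mate _ v (widePair θ i), hpos v hv, hpos _ (a1.2 hv)]
  have h8 := hneg _ (fun hc => a2.1 hc hv)
  have h9 := hneg _ (fun hc => a3.1 hc hv)
  rw [mate_mate]
  have e : ∀ (w : Fin 3) (v : Fin 4),
      mate w (mate (w + 1) (mate (w + 1) v)) = mate w v ∧
      mate w (mate (w + 2) (mate (w + 1) v)) = v ∧
      mate w (mate (w + 1) (mate (w + 2) v)) = v ∧
      mate w (mate (w + 2) (mate (w + 2) v)) = mate w v := by decide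
  obtain ⟨e1, e2, e3, e4⟩ := e (widePair θ i) v
  cases hbb : b <;> rw [hbb] at h8 h9 <;>
    simp only [Bool.not_true, Bool.not_false, if_true, Bool.false_eq_true, if_false,
      e1, e2, e3, e4] at h8 h9 <;> linarith

end IdealTriangulation

/-! ### The lower bound for each angle, and the conclusion. -/

namespace IdealTriangulation

theorem eq_widePair_or {ι : Type*} (θ : AngleVector ι) (i : ι) (b : Bool) (p : Fin 3) :
    p = widePair θ i ∨ p = widePair θ i + (if b then 1 else 2) ∨
      p = widePair θ i + (if !b then 1 else 2) := by
  generalize widePair θ i = w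
  revert w p b
  decide

variable {ι : Type*} [Fintype ι] {τ : IdealTriangulation ι} {θ : AngleVector ι}
  {out : ι → Fin 4 → Bool}

theorem IsTransverseTaut.le_angle (ht : τ.IsTransverseTaut θ out) (h : τ.IsVeering θ)
    (i : ι) (p : Fin 3) :
    Real.pi / (12 * (τ.dMax θ : ℝ) ^ 2) ≤ θ i p + Real.pi / 6 * τ.hingeDeformation θ i p +
      Real.pi / 24 / (τ.dMax θ : ℝ) ^ 2 * τ.rescueDeformation θ out i p := by
  set d := (τ.dMax θ : ℝ) with hd
  have hd2 : 0 ≤ d - 2 := h.sub_two_nonneg (i, 0)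
  have hd0 : 0 < d := by linarith
  have hdd : 0 < d ^ 2 := by positivity
  have hpi := Real.pi_pos
  set a := Real.pi / 24 / d ^ 2 with ha
  have ha0 : 0 < a := by positivity
  have had : a * d ^ 2 = Real.pi / 24 := by rw [ha]; field_simp
  have hlhs : Real.pi / (12 * d ^ 2) = 2 * a := by rw [ha]; field_simp; norm_num
  rw [hlhs, h.1.apply_eq]
  -- The bound d ≥ 2 comes from H + 2 ≤ d.
  have h4 : 4 ≤ d ^ 2 := by nlinarith
  have hsmall : a * 4 ≤ a * d ^ 2 := mul_le_mul_of_nonneg_left h4 ha0.le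
  have hthin : ∀ b : Bool, (widePair θ i + if b then 1 else 2) ≠ widePair θ i := fun b hc =>
    thinCorner_ne_wideCorner b (i, (0 : Fin 4)) (i, 0)
      (by simp only [thinCorner, wideCorner, Prod.mk.injEq, true_and]; exact hc)
  have hwide : p = widePair θ i → 2 * a ≤ (if p = widePair θ i then Real.pi else 0) +
      Real.pi / 6 * τ.hingeDeformation θ i p + a * τ.rescueDeformation θ out i p := by
    rintro rfl
    have h1 := mul_le_mul_of_nonneg_left (ht.rescueDeformation_wide h i) ha0.le
    rw [if_pos rfl, h.hingeDeformation_widePair]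
    -- The loss is at most 6ad² = π/4, out of π/3; the remaining π/12 exceeds 2a.
    have h2 : a * (6 * (d - 2) ^ 2) ≤ a * (6 * d ^ 2) :=
      mul_le_mul_of_nonneg_left (by nlinarith) ha0.le
    rw [← hd] at h1
    linarith
  by_cases hi : τ.IsHinge θ i
  · have hhinge : ∀ b : Bool, p = widePair θ i + (if b then 1 else 2) →
        2 * a ≤ (if p = widePair θ i then Real.pi else 0) +
        Real.pi / 6 * τ.hingeDeformation θ i p + a * τ.rescueDeformation θ out i p := by
      rintro b rfl
      rw [if_neg (hthin b), h.hingeDeformation_of_isHinge hi]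
      have h1 := mul_le_mul_of_nonneg_left (ht.rescueDeformation_of_isHinge h i b) ha0.le
      -- The loss is at most 2ad² = π/12, out of π/3.
      have h2 : a * (2 * (d - 2) ^ 2 + 2 * (d - 2)) ≤ a * (2 * d ^ 2) :=
        mul_le_mul_of_nonneg_left (by nlinarith) ha0.le
      rw [← hd] at h1
      linarith
    rcases eq_widePair_or θ i true p with hp | hp | hp
    · exact hwide hp
    · exact hhinge true hp
    · exact hhinge false hp
  · obtain ⟨h1, h2⟩ := h.hingeDeformation_of_not_isHinge hi 0
    rcases eq_widePair_or θ i (τ.wideColour θ (i, 0)) p with hp | hp | hp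
    · exact hwide hp
    · rw [hp, if_neg (hthin _), h1]
      have h3 := mul_nonneg ha0.le (ht.rescueDeformation_rung h hi 0)
      linarith
    · rw [hp, if_neg (hthin _), h2]
      -- This angle is 0 before the rescue, so it is the one that dictates the bound 2a = π/(12 d²).
      have h3 := mul_le_mul_of_nonneg_left (ht.rescueDeformation_pole h hi 0) ha0.le
      linarith

end IdealTriangulation

end Veering

theorem proposition4p1 {ι : Type*} [Fintype ι] [Nonempty ι]
    (τ : Veering.IdealTriangulation ι) (θ₀ : Veering.AngleVector ι) (hveer : τ.IsVeering θ₀)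
    (out : ι → Fin 4 → Bool) (htrans : τ.IsTransverseTaut θ₀ out) :
    0 < τ.dMax θ₀ ∧ 3 < τ.eMax ∧
    ∃ θ : Veering.AngleVector ι, τ.IsPositiveAngleStructure θ ∧
      (∀ i p, Real.pi / (12 * (τ.dMax θ₀ : ℝ) ^ 2) ≤ θ i p) ∧
      Real.pi / (12 * ((τ.eMax : ℝ) - 3) ^ 2) ≤ Real.pi / (12 * (τ.dMax θ₀ : ℝ) ^ 2) ∧
      θ = θ₀ + (Real.pi / 6) • τ.hingeDeformation θ₀ +
        (Real.pi / 24 / (τ.dMax θ₀ : ℝ) ^ 2) • τ.rescueDeformation θ₀ out := by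
  have hd := hveer.dMax_pos
  have he := hveer.dMax_add_three_le
  have hd' : (0 : ℝ) < τ.dMax θ₀ := by exact_mod_cast hd
  have he' : (τ.dMax θ₀ : ℝ) + 3 ≤ τ.eMax := by exact_mod_cast he
  have hpi := Real.pi_pos
  have hle := htrans.le_angle hveer
  refine ⟨hd, by omega, θ₀ + (Real.pi / 6) • τ.hingeDeformation θ₀ +
    (Real.pi / 24 / (τ.dMax θ₀ : ℝ) ^ 2) • τ.rescueDeformation θ₀ out,
    ⟨?_, fun i p => lt_of_lt_of_le (by positivity) (hle i p)⟩, hle, ?_, rfl⟩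
  · rw [add_assoc]
    exact hveer.1.1.add (Submodule.add_mem _
      (Submodule.smul_mem _ _ Veering.IdealTriangulation.hingeDeformation_mem)
      (Submodule.smul_mem _ _ (htrans.rescueDeformation_mem hveer)))
  · have h1 : (τ.dMax θ₀ : ℝ) ≤ (τ.eMax : ℝ) - 3 := by linarith
    gcongr
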